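/- Let $(X_n)_{n\ge 1}$ be independent copies of a real random variable $X$ with $\mathbb E X=0$, $\operatorname{Var}(X)=1$ and $\mathbb E\,e^{b|X|}<\infty$ for some $b>0$. Put $Z_n=(X_1+\dots+X_n)/\sqrt n$, and suppose that $Z_{n_0}$ has a bounded density for some integer $n_0\ge 1$. Let $\varphi(x)=\frac{1}{\sqrt{2\pi}}e^{-x^2/2}$, and let $\gamma_k=\frac{d^k}{dt^k}\log \mathbb E\,e^{tX}\big|_{t=0}$ denote the cumulants of $X$. Suppose that the first nonzero cumulant $\gamma_m$ of order $m\ge 3$ has even order $m\ge 4$ and satisfies $\gamma_m<0$. Then for every $n\ge 2n_0$ the variable $Z_n$ has a bounded continuous density $p_n$ (the continuous density being unique), and there exist constants $\tau_0>0$ and $c>0$, which do not depend on $n$ and $x$, such that for all $n\ge 2n_0$ and all $x\in\mathbb R$ with $|x|/\sqrt n\le\tau_0$, $$\frac{p_n(x)-\varphi(x)}{\varphi(x)}\le \frac{c\,(\log n)^3}{n}.$$ -/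

import Mathlib

open MeasureTheory ProbabilityTheory

noncomputable section

namespace LocalLimit

/-- The `k`-th cumulant of the real random variable `X` under `P`: the `k`-th derivative at `0`
of its log-Laplace transform `t ↦ log E exp (t X)`. -/
def cumulant {Ω : Type*} [MeasurableSpace Ω] (X : Ω → ℝ) (P : Measure Ω) (k : ℕ) : ℝ :=
  iteratedDeriv k (cgf X P) 0

/-- The normalized sum `(ξ₀ + ⋯ + ξₙ₋₁) / √n` of the first `n` terms of a sequence. -/
def normalizedSum {Ω : Type*} (ξ : ℕ → Ω → ℝ) (n : ℕ) (ω : Ω) : ℝ :=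
  (∑ i ∈ Finset.range n, ξ i ω) / √(n : ℝ)

/-- `p` is a probability density, with respect to Lebesgue measure, of the random variable `Y`. -/
structure IsDensity {Ω : Type*} [MeasurableSpace Ω] (p : ℝ → ℝ) (Y : Ω → ℝ)
    (P : Measure Ω) : Prop where
  measurable : Measurable p
  nonneg : ∀ x, 0 ≤ p x
  hasLaw : HasLaw Y (volume.withDensity fun x => ENNReal.ofReal (p x)) P

/-- `p` is bounded from above by a constant. -/
def IsBoundedAbove (p : ℝ → ℝ) : Prop :=
  ∃ M : ℝ, ∀ x, p x ≤ M

end LocalLimit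

end

/-!
By Fourier inversion for the density of `Zₙ` tilted by `exp (√n s x)`, at the saddlepoint
`x = √n K'(s)` of the cumulant generating function `K`,
`p(x) / φ(x) ≤ exp (-n (s K' - K - K'² / 2)) * √(n / 2π) ∫ |f_s(t)|ⁿ dt`,
where `f_s` is the characteristic function of `X` tilted by `exp (s x)`. Laplace's method, uniformly
for `s` near `0`, bounds the last factor by `1 / √K''(s) + A / n`. If the first nonzero higher
cumulant `γ_m` is negative and `m` is even, the exponent `s K' - K - K'² / 2` is at least `c s ^ m`,
while `|K''(s) - 1| ≤ D y` with `y = |s| ^ (m - 2)` and `y² ≤ s ^ m`; since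
`exp (-c n y²) * (1 + 2 D y) ≤ 1 + D² / (c n)`, the gain in the exponent outweighs the loss in the
variance up to `O(1 / n)`.
-/

noncomputable section

namespace LocalLimit

open scoped FourierTransform SchwartzMap
open Filter Topology

/-! ### Fourier inversion and Plancherel's identity for integrable functions -/

section Fourier

variable {V : Type*} [NormedAddCommGroup V] [InnerProductSpace ℝ V] [FiniteDimensional ℝ V]
  [MeasurableSpace V] [BorelSpace V] {f g : V → ℂ}

lemma ae_eq_of_forall_schwartz_integral_mul_eq (hf : LocallyIntegrable f)
    (hg : LocallyIntegrable g) (h : ∀ u : 𝓢(V, ℂ), ∫ x, u x * f x = ∫ x, u x * g x) :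
    f =ᵐ[volume] g := by
  refine ae_eq_of_integral_contDiff_smul_eq hf hg fun u hu hc => ?_
  have hc' : HasCompactSupport (Complex.ofRealCLM ∘ u) := hc.comp_left rfl
  have hu' : ContDiff ℝ ((⊤ : ℕ∞) : WithTop ℕ∞) (Complex.ofRealCLM ∘ u) := by fun_prop
  simpa using h (hc'.toSchwartzMap hu')

lemma integral_fourier_mul_eq (hf : Integrable f) (hg : Integrable g) :
    ∫ x, 𝓕 f x * g x = ∫ x, f x * 𝓕 g x := by
  simpa using! VectorFourier.integral_fourierIntegral_smul_eq_flip (L := innerₗ V)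
    Real.continuous_fourierChar continuous_inner hf hg

lemma continuous_fourier (hf : Integrable f) : Continuous (𝓕 f) :=
  VectorFourier.fourierIntegral_continuous Real.continuous_fourierChar (by exact continuous_inner)
    hf

lemma continuous_fourierInv (hf : Integrable f) : Continuous (𝓕⁻ f) := by
  rw [Real.fourierInv_eq_fourier_comp_neg]
  exact continuous_fourier hf.comp_neg

lemma norm_fourierInv_le_integral_norm (f : V → ℂ) (x : V) : ‖𝓕⁻ f x‖ ≤ ∫ y, ‖f y‖ := by
  rw [Real.fourierInv_eq_fourier_neg]
  exact VectorFourier.norm_fourierIntegral_le_integral_norm _ _ _ _ _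

lemma fourierInv_fourier_ae_eq (hf : Integrable f) (hf' : Integrable (𝓕 f)) :
    𝓕⁻ (𝓕 f) =ᵐ[volume] f := by
  refine ae_eq_of_forall_schwartz_integral_mul_eq
    (continuous_fourierInv hf').locallyIntegrable hf.locallyIntegrable fun u => ?_
  have hu : 𝓕⁻ (u : V → ℂ) = 𝓕 fun x => u (-x) := Real.fourierInv_eq_fourier_comp_neg _
  calc ∫ x, u x * 𝓕⁻ (𝓕 f) x = ∫ x, u (-x) * 𝓕 (𝓕 f) x := by
        rw [← integral_neg_eq_self]
        simp only [Real.fourierInv_eq_fourier_neg, neg_neg]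
    _ = ∫ x, 𝓕⁻ (u : V → ℂ) x * 𝓕 f x := by
        rw [hu, integral_fourier_mul_eq u.integrable.comp_neg hf']
    _ = ∫ x, 𝓕 f x * (𝓕⁻ u : 𝓢(V, ℂ)) x := by simp_rw [SchwartzMap.fourierInv_coe, mul_comm]
    _ = ∫ x, f x * 𝓕 (𝓕⁻ u : 𝓢(V, ℂ)) x := by
        rw [integral_fourier_mul_eq hf (𝓕⁻ u).integrable, SchwartzMap.fourier_coe]
    _ = ∫ x, u x * f x := by simp_rw [FourierTransform.fourier_fourierInv_eq, mul_comm]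

lemma fourier_toLp_ae_eq (hf : Integrable f) (hf2 : MemLp f 2) :
    (𝓕 (hf2.toLp f) : Lp ℂ 2 (volume : Measure V)) =ᵐ[volume] 𝓕 f := by
  refine ae_eq_of_forall_schwartz_integral_mul_eq
    ((Lp.memLp _).locallyIntegrable one_le_two)
    (continuous_fourier hf).locallyIntegrable fun u => ?_
  have hu := congrArg (· u) (Lp.fourier_toTemperedDistribution_eq (hf2.toLp f))
  simp only [TemperedDistribution.fourier_apply, Lp.toTemperedDistribution_apply,
    smul_eq_mul] at hu
  calc ∫ x, u x * (𝓕 (hf2.toLp f) : Lp ℂ 2 (volume : Measure V)) x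
      = ∫ x, 𝓕 u x * (hf2.toLp f) x := hu.symm
    _ = ∫ x, 𝓕 u x * f x :=
        integral_congr_ae (hf2.coeFn_toLp.mono fun x hx => congrArg (𝓕 u x * ·) hx)
    _ = ∫ x, u x * 𝓕 f x := by
        rw [SchwartzMap.fourier_coe, integral_fourier_mul_eq u.integrable hf]

lemma norm_toLp_two_sq {α E : Type*} [MeasurableSpace α] [NormedAddCommGroup E] {μ : Measure α}
    {h : α → E} (hh : MemLp h 2 μ) : ‖hh.toLp h‖ ^ 2 = ∫ x, ‖h x‖ ^ 2 ∂μ := by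
  have h0 : 0 ≤ ∫ x, ‖h x‖ ^ 2 ∂μ := by positivity
  rw [Lp.norm_toLp, hh.eLpNorm_eq_integral_rpow_norm two_ne_zero ENNReal.ofNat_ne_top]
  simp only [ENNReal.toReal_ofNat, Real.rpow_ofNat]
  rw [ENNReal.toReal_ofReal (by positivity), ← Real.rpow_mul_natCast h0]
  norm_num

lemma memLp_fourier (hf : Integrable f) (hf2 : MemLp f 2) : MemLp (𝓕 f) 2 :=
  (Lp.memLp _).ae_eq (fourier_toLp_ae_eq hf hf2)

lemma integral_norm_fourier_sq (hf : Integrable f) (hf2 : MemLp f 2) :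
    ∫ x, ‖𝓕 f x‖ ^ 2 = ∫ x, ‖f x‖ ^ 2 := by
  have hF := memLp_fourier hf hf2
  have hae : hF.toLp (𝓕 f) = 𝓕 (hf2.toLp f) :=
    Lp.ext (hF.coeFn_toLp.trans (fourier_toLp_ae_eq hf hf2).symm)
  rw [← norm_toLp_two_sq hF, ← norm_toLp_two_sq hf2, hae, Lp.norm_fourier_eq]

end Fourier

/-! ### Densities and their Laplace transforms on vertical lines -/

section Density

variable {Ω : Type*} [MeasurableSpace Ω] {P : Measure Ω} {Y : Ω → ℝ} {p q : ℝ → ℝ}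

lemma exists_isDensity_of_absolutelyContinuous [IsFiniteMeasure P] (hY : AEMeasurable Y P)
    (hac : P.map Y ≪ volume) : ∃ p : ℝ → ℝ, IsDensity p Y P := by
  refine ⟨fun y => ((P.map Y).rnDeriv volume y).toReal,
    (Measure.measurable_rnDeriv _ _).ennreal_toReal, fun _ => ENNReal.toReal_nonneg, hY, ?_⟩
  conv_lhs => rw [← Measure.withDensity_rnDeriv_eq _ _ hac]
  refine withDensity_congr_ae ?_
  filter_upwards [Measure.rnDeriv_ne_top (P.map Y) volume] with y hy
  rw [ENNReal.ofReal_toReal hy]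

lemma IsDensity.absolutelyContinuous (hp : IsDensity p Y P) : P.map Y ≪ volume := by
  rw [hp.hasLaw.map_eq]
  exact withDensity_absolutelyContinuous _ _

lemma IsDensity.congr (hp : IsDensity p Y P) (hq : Measurable q) (hq0 : ∀ x, 0 ≤ q x)
    (hpq : p =ᵐ[volume] q) : IsDensity q Y P where
  measurable := hq
  nonneg := hq0
  hasLaw.aemeasurable := hp.hasLaw.aemeasurable
  hasLaw.map_eq := by
    rw [hp.hasLaw.map_eq]
    exact withDensity_congr_ae (hpq.mono fun y hy => congrArg ENNReal.ofReal hy)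

section Composition

variable {E : Type*} [NormedAddCommGroup E] [NormedSpace ℝ E] {g : ℝ → E}

lemma IsDensity.integral_comp (hp : IsDensity p Y P) (hg : StronglyMeasurable g) :
    ∫ ω, g (Y ω) ∂P = ∫ y, p y • g y := by
  have h := hp.hasLaw.integral_comp (f := g) hg.aestronglyMeasurable
  rw [integral_withDensity_eq_integral_toReal_smul hp.measurable.ennreal_ofReal (by simp)] at h
  simpa only [Function.comp_def, ENNReal.toReal_ofReal (hp.nonneg _)] using h

lemma IsDensity.integrable_comp_iff (hp : IsDensity p Y P) (hg : StronglyMeasurable g) :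
    Integrable (fun ω => g (Y ω)) P ↔ Integrable fun y => p y • g y := by
  have h := integrable_map_measure (f := Y) (μ := P) hg.aestronglyMeasurable hp.hasLaw.aemeasurable
  rw [hp.hasLaw.map_eq,
    integrable_withDensity_iff_integrable_smul' hp.measurable.ennreal_ofReal (by simp)] at h
  simpa only [Function.comp_def, ENNReal.toReal_ofReal (hp.nonneg _)] using h.symm

end Composition

/-- The exponentially tilted density `y ↦ p y * exp (a * y)`, not normalized, and complex-valued so
that its Fourier transform makes sense. -/
def expTilt (p : ℝ → ℝ) (a : ℝ) (y : ℝ) : ℂ := ((p y * Real.exp (a * y) : ℝ) : ℂ)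

lemma IsDensity.norm_expTilt (hp : IsDensity p Y P) (a y : ℝ) :
    ‖expTilt p a y‖ = p y * Real.exp (a * y) :=
  Complex.norm_of_nonneg (mul_nonneg (hp.nonneg y) (Real.exp_nonneg _))

lemma IsDensity.integrable_expTilt (hp : IsDensity p Y P) {a : ℝ}
    (ha : a ∈ integrableExpSet Y P) : Integrable (expTilt p a) :=
  ((hp.integrable_comp_iff (g := fun y => Real.exp (a * y))
    (by fun_prop : Measurable _).stronglyMeasurable).1 ha).ofReal

lemma IsDensity.fourier_expTilt (hp : IsDensity p Y P) (a : ℝ) :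
    𝓕 (expTilt p a) = fun w => complexMGF Y P (a + (-(2 * Real.pi) * w : ℝ) * Complex.I) := by
  ext w
  rw [complexMGF, hp.integral_comp (g := fun y : ℝ => Complex.exp
    ((a + (-(2 * Real.pi) * w : ℝ) * Complex.I) * y))
    (by fun_prop : Measurable _).stronglyMeasurable, Real.fourier_real_eq_integral_exp_smul]
  refine integral_congr_ae (ae_of_all _ fun y => ?_)
  simp only [expTilt, smul_eq_mul, Complex.real_smul]
  push_cast
  rw [mul_comm, mul_assoc, ← Complex.exp_add]
  ring_nf

lemma integral_comp_neg_two_pi_mul (g : ℝ → ℝ) :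
    ∫ w, g (-(2 * Real.pi) * w) = (2 * Real.pi)⁻¹ * ∫ t, g t := by
  rw [Measure.integral_comp_mul_left, inv_neg, abs_neg, abs_of_pos (by positivity), smul_eq_mul]

lemma IsDensity.integrable_fourier_expTilt_iff (hp : IsDensity p Y P) (a : ℝ) :
    Integrable (𝓕 (expTilt p a)) ↔
      Integrable fun t : ℝ => complexMGF Y P (a + t * Complex.I) := by
  rw [hp.fourier_expTilt]
  exact integrable_comp_mul_left_iff (fun t : ℝ => complexMGF Y P (a + t * Complex.I))
    (neg_ne_zero.2 Real.two_pi_pos.ne')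

lemma IsDensity.mul_exp_le_integral_norm_complexMGF (hp : IsDensity p Y P) (hc : Continuous p)
    {a : ℝ} (ha : a ∈ integrableExpSet Y P)
    (hint : Integrable fun t : ℝ => complexMGF Y P (a + t * Complex.I)) (x : ℝ) :
    p x * Real.exp (a * x) ≤ (2 * Real.pi)⁻¹ * ∫ t : ℝ, ‖complexMGF Y P (a + t * Complex.I)‖ := by
  have hcont : Continuous (expTilt p a) := by unfold expTilt; fun_prop
  have hinv := hcont.fourierInv_fourier_eq (hp.integrable_expTilt ha)
    ((hp.integrable_fourier_expTilt_iff a).2 hint)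
  calc p x * Real.exp (a * x) = ‖𝓕⁻ (𝓕 (expTilt p a)) x‖ := by rw [hinv, hp.norm_expTilt]
    _ ≤ ∫ w, ‖𝓕 (expTilt p a) w‖ := norm_fourierInv_le_integral_norm _ _
    _ = (2 * Real.pi)⁻¹ * ∫ t : ℝ, ‖complexMGF Y P (a + t * Complex.I)‖ := by
      rw [hp.fourier_expTilt]
      exact integral_comp_neg_two_pi_mul fun t => ‖complexMGF Y P (a + t * Complex.I)‖

lemma IsDensity.norm_expTilt_sq_le (hp : IsDensity p Y P) {B : ℝ} (hB : ∀ y, p y ≤ B) (a y : ℝ) :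
    ‖expTilt p a y‖ ^ 2 ≤ B * (p y • Real.exp (2 * a * y)) := by
  have hp0 := hp.nonneg y
  calc ‖expTilt p a y‖ ^ 2 = p y * (p y * Real.exp (2 * a * y)) := by
        rw [hp.norm_expTilt, mul_pow, ← Real.exp_nat_mul]; push_cast; ring_nf
    _ ≤ B * (p y * Real.exp (2 * a * y)) := by gcongr; exact hB y

lemma IsDensity.integrable_smul_exp (hp : IsDensity p Y P) {a : ℝ}
    (ha : a ∈ integrableExpSet Y P) : Integrable fun y => p y • Real.exp (a * y) :=
  (hp.integrable_comp_iff (by fun_prop : Measurable _).stronglyMeasurable).1 ha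

lemma IsDensity.memLp_expTilt (hp : IsDensity p Y P) (hb : IsBoundedAbove p) {a : ℝ}
    (ha : a ∈ integrableExpSet Y P) (ha2 : 2 * a ∈ integrableExpSet Y P) :
    MemLp (expTilt p a) 2 := by
  obtain ⟨B, hB⟩ := hb
  have hI := hp.integrable_expTilt ha
  refine (memLp_two_iff_integrable_sq_norm hI.1).2 <|
    ((hp.integrable_smul_exp ha2).const_mul B).mono' (hI.aestronglyMeasurable.norm.pow 2) <|
    ae_of_all _ fun y => ?_
  simpa using hp.norm_expTilt_sq_le hB a y

lemma IsDensity.integrable_norm_complexMGF_sq (hp : IsDensity p Y P) (hb : IsBoundedAbove p)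
    {a : ℝ} (ha : a ∈ integrableExpSet Y P) (ha2 : 2 * a ∈ integrableExpSet Y P) :
    Integrable fun t : ℝ => ‖complexMGF Y P (a + t * Complex.I)‖ ^ 2 := by
  have h := (memLp_fourier (hp.integrable_expTilt ha)
    (hp.memLp_expTilt hb ha ha2)).integrable_norm_pow two_ne_zero
  rw [hp.fourier_expTilt] at h
  exact (integrable_comp_mul_left_iff
    (fun t : ℝ => ‖complexMGF Y P (a + t * Complex.I)‖ ^ 2)
    (neg_ne_zero.2 Real.two_pi_pos.ne')).1 h

lemma IsDensity.integral_norm_complexMGF_sq_le (hp : IsDensity p Y P) {B : ℝ}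
    (hB : ∀ y, p y ≤ B) {a : ℝ} (ha : a ∈ integrableExpSet Y P)
    (ha2 : 2 * a ∈ integrableExpSet Y P) :
    ∫ t : ℝ, ‖complexMGF Y P (a + t * Complex.I)‖ ^ 2 ≤ 2 * Real.pi * (B * mgf Y P (2 * a)) := by
  have hL2 := hp.memLp_expTilt ⟨B, hB⟩ ha ha2
  have hplancherel := integral_norm_fourier_sq (hp.integrable_expTilt ha) hL2
  rw [hp.fourier_expTilt,
    integral_comp_neg_two_pi_mul fun t => ‖complexMGF Y P (a + t * Complex.I)‖ ^ 2,
    inv_mul_eq_iff_eq_mul₀ Real.two_pi_pos.ne'] at hplancherel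
  rw [hplancherel]
  gcongr
  calc ∫ y, ‖expTilt p a y‖ ^ 2 ≤ ∫ y, B * (p y • Real.exp (2 * a * y)) :=
        integral_mono (hL2.integrable_norm_pow two_ne_zero)
          ((hp.integrable_smul_exp ha2).const_mul B) (hp.norm_expTilt_sq_le hB a)
    _ = B * mgf Y P (2 * a) := by
        rw [integral_const_mul, mgf, hp.integral_comp (g := fun y => Real.exp (2 * a * y))
          (by fun_prop : Measurable _).stronglyMeasurable]

lemma exists_continuous_isDensity [IsFiniteMeasure P] (hY : AEMeasurable Y P)
    (hac : P.map Y ≪ volume)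
    (hint : Integrable fun t : ℝ => complexMGF Y P (t * Complex.I)) :
    ∃ p : ℝ → ℝ, Continuous p ∧ IsBoundedAbove p ∧ IsDensity p Y P := by
  obtain ⟨q, hq⟩ := exists_isDensity_of_absolutelyContinuous hY hac
  have hF : Integrable (𝓕 (expTilt q 0)) :=
    (hq.integrable_fourier_expTilt_iff 0).2 (by simpa using hint)
  have hinv := fourierInv_fourier_ae_eq (hq.integrable_expTilt (by simp [integrableExpSet])) hF
  have hcont : Continuous fun x => max (𝓕⁻ (𝓕 (expTilt q 0)) x).re 0 :=
    (Complex.continuous_re.comp (continuous_fourierInv hF)).max continuous_const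
  refine ⟨_, hcont, ⟨∫ w, ‖𝓕 (expTilt q 0) w‖, fun x => ?_⟩,
    hq.congr hcont.measurable (fun x => le_max_right _ _) ?_⟩
  · exact max_le ((Complex.re_le_norm _).trans (norm_fourierInv_le_integral_norm _ _))
      (by positivity)
  · filter_upwards [hinv] with x hx
    simp [hx, expTilt, hq.nonneg x]

end Density

/-! ### Normalized sums of independent copies -/

section Sum

lemma absolutelyContinuous_map_const_mul {Ω : Type*} [MeasurableSpace Ω] {P : Measure Ω}
    {Y : Ω → ℝ} (hY : AEMeasurable Y P) {c : ℝ} (hc : c ≠ 0) (hac : P.map Y ≪ volume) :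
    P.map (fun ω => c * Y ω) ≪ volume := by
  have hmap : P.map (fun ω => c * Y ω) = (P.map Y).map (c * ·) :=
    (AEMeasurable.map_map_of_aemeasurable (by fun_prop) hY).symm
  rw [hmap]
  refine (hac.map (by fun_prop)).trans ?_
  rw [Real.map_volume_mul_left hc]
  exact Measure.smul_absolutelyContinuous

variable {Ω Ω' : Type*} [MeasurableSpace Ω] [MeasurableSpace Ω'] {P : Measure Ω}
  {P' : Measure Ω'} {X : Ω → ℝ} {ξ : ℕ → Ω' → ℝ}

lemma absolutelyContinuous_map_sum_range (hindep : iIndepFun ξ P')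
    (hm : ∀ i, AEMeasurable (ξ i) P') {k n : ℕ} (hkn : k ≤ n)
    (hac : P'.map (∑ i ∈ Finset.range k, ξ i) ≪ volume) :
    P'.map (∑ i ∈ Finset.range n, ξ i) ≪ volume := by
  have := hindep.isProbabilityMeasure
  induction n, hkn using Nat.le_induction with
  | base => exact hac
  | succ n _ ih =>
    rw [Finset.sum_range_succ, add_comm,
      (hindep.indepFun_finsetSum_of_notMem₀ hm Finset.notMem_range_self).symm
        |>.map_add_eq_map_conv_map₀ (hm n) (Finset.aemeasurable_sum _ fun i _ => hm i)]
    exact Measure.conv_absolutelyContinuous ih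

lemma aemeasurable_normalizedSum (hm : ∀ i, AEMeasurable (ξ i) P') (n : ℕ) :
    AEMeasurable (normalizedSum ξ n) P' :=
  (Finset.aemeasurable_fun_sum _ fun i _ => hm i).div_const _

lemma absolutelyContinuous_map_normalizedSum (hindep : iIndepFun ξ P')
    (hm : ∀ i, AEMeasurable (ξ i) P') {k n : ℕ} (hk : 1 ≤ k) (hkn : k ≤ n)
    (hac : P'.map (normalizedSum ξ k) ≪ volume) : P'.map (normalizedSum ξ n) ≪ volume := by
  have hk0 : √(k : ℝ) ≠ 0 := by positivity
  have hn0 : (√(n : ℝ))⁻¹ ≠ 0 := by have := hk.trans hkn; positivity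
  have hsum : ∑ i ∈ Finset.range k, ξ i = fun ω => √(k : ℝ) * normalizedSum ξ k ω := by
    ext ω
    rw [normalizedSum, mul_div_cancel₀ _ hk0, Finset.sum_apply]
  have hnorm : normalizedSum ξ n = fun ω => (√(n : ℝ))⁻¹ * (∑ i ∈ Finset.range n, ξ i) ω := by
    ext ω
    rw [normalizedSum, div_eq_inv_mul, Finset.sum_apply]
  rw [hnorm]
  refine absolutelyContinuous_map_const_mul (Finset.aemeasurable_sum _ fun i _ => hm i) hn0
    (absolutelyContinuous_map_sum_range hindep hm hkn ?_)
  rw [hsum]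
  exact absolutelyContinuous_map_const_mul (aemeasurable_normalizedSum hm k) hk0 hac

lemma complexMGF_normalizedSum (hindep : iIndepFun ξ P')
    (hident : ∀ i, IdentDistrib (ξ i) X P' P) (n : ℕ) (z : ℂ) :
    complexMGF (normalizedSum ξ n) P' z = complexMGF X P (z / (√(n : ℝ) : ℝ)) ^ n := by
  set w : ℂ := z / (√(n : ℝ) : ℝ) with hw
  have hprod := (hindep.precomp (Fin.val_injective (n := n))).integral_fun_prod_comp (𝕜 := ℂ)
    (f := fun _ (x : ℝ) => Complex.exp (w * x)) (fun i => (hident i).aemeasurable_fst)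
    (fun i => (by fun_prop : Measurable _).aestronglyMeasurable)
  have hcopy : ∀ i, ∫ ω, Complex.exp (w * ξ i ω) ∂P' = complexMGF X P w := fun i =>
    congrFun (complexMGF_congr_identDistrib (hident i)) w
  simp only [hcopy, Finset.prod_const, Finset.card_univ, Fintype.card_fin] at hprod
  rw [← hprod, complexMGF]
  refine integral_congr_ae (ae_of_all _ fun ω => ?_)
  simp only [normalizedSum, ← Complex.exp_sum, Finset.sum_range, ← Finset.mul_sum]
  push_cast
  rw [hw, div_mul_eq_mul_div, mul_div_assoc]

lemma mem_integrableExpSet_normalizedSum (hindep : iIndepFun ξ P')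
    (hident : ∀ i, IdentDistrib (ξ i) X P' P) (n : ℕ) {a : ℝ}
    (ha : a / √(n : ℝ) ∈ integrableExpSet X P) :
    a ∈ integrableExpSet (normalizedSum ξ n) P' := by
  have := hindep.isProbabilityMeasure
  have hcopy : ∀ i, Integrable (fun ω => Real.exp (a / √(n : ℝ) * ξ i ω)) P' := fun i =>
    ((hident i).comp (u := fun x : ℝ => Real.exp (a / √(n : ℝ) * x))
      (by fun_prop)).integrable_iff.2 ha
  have hsum : ∀ k, Integrable
      (fun ω => Real.exp (a / √(n : ℝ) * (∑ i ∈ Finset.range k, ξ i) ω)) P' := by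
    intro k
    induction k with
    | zero => simp
    | succ k ih =>
      rw [Finset.sum_range_succ]
      exact (hindep.indepFun_finsetSum_of_notMem₀ (fun i => (hident i).aemeasurable_fst)
        Finset.notMem_range_self).integrable_exp_mul_add ih (hcopy k)
  refine (hsum n).congr (ae_of_all _ fun ω => ?_)
  simp only [normalizedSum, Finset.sum_apply]
  rw [div_mul_eq_mul_div, mul_div_assoc]

end Sum

/-! ### Characteristic functions and symmetrization -/

section CharFun

lemma one_sub_cos_two_mul_le (u : ℝ) : 1 - Real.cos (2 * u) ≤ 4 * (1 - Real.cos u) := by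
  rw [Real.cos_two_mul]
  nlinarith [sq_nonneg (1 - Real.cos u)]

lemma cos_le_one_sub_sq_add_pow_four (u : ℝ) : Real.cos u ≤ 1 - u ^ 2 / 2 + u ^ 4 / 2 := by
  rcases le_total |u| 1 with hu | hu
  · have hbound := (abs_le.1 (Real.cos_bound hu)).2
    rw [← abs_pow, abs_of_nonneg (by positivity)] at hbound
    nlinarith [show 0 ≤ u ^ 4 by positivity]
  · have hu2 : 1 ≤ u ^ 2 := (one_le_sq_iff_one_le_abs u).2 hu
    nlinarith [Real.cos_le_one u]

lemma cos_mul_sub_le (t x y : ℝ) :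
    Real.cos (t * (x - y)) ≤ 1 - t ^ 2 / 2 * (x - y) ^ 2 + 4 * t ^ 4 * (x ^ 4 + y ^ 4) := by
  have hfour : (x - y) ^ 4 ≤ 8 * (x ^ 4 + y ^ 4) := by
    nlinarith [sq_nonneg (x + y), sq_nonneg ((x + y) ^ 2), sq_nonneg (x ^ 2 - y ^ 2)]
  nlinarith [cos_le_one_sub_sq_add_pow_four (t * (x - y)),
    mul_le_mul_of_nonneg_right hfour (show 0 ≤ t ^ 4 by positivity)]

section InnerProductSpace

variable {E : Type*} [SeminormedAddCommGroup E] [InnerProductSpace ℝ E] [MeasurableSpace E]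
  [OpensMeasurableSpace E]

lemma integrable_cos_inner_sub (μ : Measure E) [IsFiniteMeasure μ] (t : E) :
    Integrable (fun z : E × E => Real.cos (inner ℝ z.1 t - inner ℝ z.2 t)) (μ.prod μ) :=
  Integrable.of_bound (C := 1) (by fun_prop : Measurable _).aestronglyMeasurable <|
    ae_of_all _ fun _ => Real.abs_cos_le_one _

variable [SecondCountableTopology E]

lemma sq_norm_charFun (μ : Measure E) [IsFiniteMeasure μ] (t : E) :
    ‖charFun μ t‖ ^ 2
      = ∫ z : E × E, Real.cos (inner ℝ z.1 t - inner ℝ z.2 t) ∂μ.prod μ := by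
  have hprod : charFun μ t * charFun μ (-t)
      = ∫ z : E × E, Complex.exp (((inner ℝ z.1 t - inner ℝ z.2 t : ℝ) : ℂ) * Complex.I)
          ∂μ.prod μ := by
    rw [charFun_apply, charFun_apply, ← integral_prod_mul]
    simp only [inner_neg_right, ← Complex.exp_add, ← add_mul, ← sub_eq_add_neg,
      Complex.ofReal_neg, Complex.ofReal_sub]
  have hint : Integrable (fun z : E × E =>
      Complex.exp (((inner ℝ z.1 t - inner ℝ z.2 t : ℝ) : ℂ) * Complex.I)) (μ.prod μ) :=
    Integrable.of_bound (C := 1) (by fun_prop : Measurable _).aestronglyMeasurable <|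
      ae_of_all _ fun _ => (Complex.norm_exp_ofReal_mul_I _).le
  rw [charFun_neg, Complex.mul_conj, Complex.normSq_eq_norm_sq] at hprod
  calc ‖charFun μ t‖ ^ 2 = RCLike.re ((‖charFun μ t‖ ^ 2 : ℝ) : ℂ) := rfl
    _ = _ := by
      rw [hprod, ← integral_re hint]
      simp only [RCLike.re_eq_complex_re, Complex.exp_ofReal_mul_I_re]

variable {μ : Measure E} [IsProbabilityMeasure μ]

lemma one_sub_sq_norm_charFun_two_smul_le (t : E) :
    1 - ‖charFun μ ((2 : ℝ) • t)‖ ^ 2 ≤ 4 * (1 - ‖charFun μ t‖ ^ 2) := by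
  have hsymm : ∀ u : E, 1 - ‖charFun μ u‖ ^ 2
      = ∫ z : E × E, (1 - Real.cos (inner ℝ z.1 u - inner ℝ z.2 u)) ∂μ.prod μ := fun u => by
    rw [sq_norm_charFun, integral_sub (integrable_const _) (integrable_cos_inner_sub μ u)]
    simp
  have hint : ∀ u : E, Integrable
      (fun z : E × E => 1 - Real.cos (inner ℝ z.1 u - inner ℝ z.2 u)) (μ.prod μ) := fun u =>
    (integrable_const _).sub (integrable_cos_inner_sub μ u)
  rw [hsymm, hsymm, ← integral_const_mul]
  refine integral_mono (hint _) ((hint t).const_mul 4) fun z => ?_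
  simpa only [inner_smul_right, mul_sub] using
    one_sub_cos_two_mul_le (inner ℝ z.1 t - inner ℝ z.2 t)

lemma one_sub_sq_norm_charFun_two_pow_smul_le (t : E) (N : ℕ) :
    1 - ‖charFun μ ((2 : ℝ) ^ N • t)‖ ^ 2 ≤ 4 ^ N * (1 - ‖charFun μ t‖ ^ 2) := by
  induction N with
  | zero => simp
  | succ N ih =>
    have hdouble := one_sub_sq_norm_charFun_two_smul_le (μ := μ) ((2 : ℝ) ^ N • t)
    rw [smul_smul, ← pow_succ'] at hdouble
    rw [pow_succ' (4 : ℝ)]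
    linarith

lemma exists_lt_one_forall_norm_charFun_le
    (hdecay : Tendsto (charFun μ) (Bornology.cobounded E) (𝓝 0)) {ε : ℝ} (hε : 0 < ε) :
    ∃ ρ ∈ Set.Ico (0 : ℝ) 1, ∀ t, ε ≤ ‖t‖ → ‖charFun μ t‖ ≤ ρ := by
  obtain ⟨R, -, hR⟩ := (hasBasis_cobounded_norm (E := E)).eventually_iff.1
    (hdecay.norm.eventually_le_const (by simp : ‖(0 : ℂ)‖ < 1 / 2))
  obtain ⟨N, hN⟩ := pow_unbounded_of_one_lt (R / ε) one_lt_two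
  refine ⟨√(1 - 3 / 4 ^ (N + 1)), ⟨Real.sqrt_nonneg _, ?_⟩, fun t ht => Real.le_sqrt_of_sq_le ?_⟩
  · rw [Real.sqrt_lt' one_pos]
    linarith [show (0 : ℝ) < 3 / 4 ^ (N + 1) by positivity]
  · have hfar : R ≤ ‖(2 : ℝ) ^ N • t‖ := by
      rw [norm_smul, norm_pow, Real.norm_ofNat]
      exact ((div_lt_iff₀ hε).1 hN).le.trans (by gcongr)
    have hhalf : ‖charFun μ ((2 : ℝ) ^ N • t)‖ ^ 2 ≤ (1 / 2) ^ 2 := by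
      gcongr
      exact hR hfar
    have hpow := one_sub_sq_norm_charFun_two_pow_smul_le (μ := μ) t N
    have : 3 / 4 ^ (N + 1) ≤ 1 - ‖charFun μ t‖ ^ 2 := by
      rw [div_le_iff₀ (by positivity), pow_succ (4 : ℝ)]
      linarith
    linarith

end InnerProductSpace

section Real

variable {μ : Measure ℝ} [IsProbabilityMeasure μ]

lemma integral_sub_sq_prod (hμ : MemLp id 2 μ) :
    ∫ z : ℝ × ℝ, (z.1 - z.2) ^ 2 ∂μ.prod μ = 2 * variance id μ := by
  have hint : Integrable (fun x : ℝ => x) μ := hμ.integrable one_le_two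
  have hmean : ∫ z : ℝ × ℝ, (z.1 - z.2) ∂μ.prod μ = 0 := by
    rw [integral_sub (hint.comp_fst μ) (hint.comp_snd μ), integral_fun_fst (fun x => x),
      integral_fun_snd (fun x => x), sub_self]
  have hvar := variance_add_prod hμ hμ.neg
  simp only [Pi.neg_apply, id_eq, ← sub_eq_add_neg] at hvar
  rw [← variance_of_integral_eq_zero (by fun_prop) hmean, hvar, variance_neg, two_mul]

lemma sq_norm_charFun_le (hμ : MemLp id 4 μ) (t : ℝ) :
    ‖charFun μ t‖ ^ 2 ≤ 1 - variance id μ * t ^ 2 + 8 * (∫ x, x ^ 4 ∂μ) * t ^ 4 := by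
  have hμ2 : MemLp id 2 μ := hμ.mono_exponent (by norm_num)
  have h4 : Integrable (fun x : ℝ => x ^ 4) μ := by
    simpa [Even.pow_abs (show Even 4 by decide)] using hμ.integrable_norm_pow four_ne_zero
  have hfst : Integrable (fun z : ℝ × ℝ => z.1 ^ 4) (μ.prod μ) := h4.comp_fst μ
  have hsnd : Integrable (fun z : ℝ × ℝ => z.2 ^ 4) (μ.prod μ) := h4.comp_snd μ
  have hsq : Integrable (fun z : ℝ × ℝ => t ^ 2 / 2 * (z.1 - z.2) ^ 2) (μ.prod μ) :=
    ((hμ2.comp_fst μ).sub (hμ2.comp_snd μ)).integrable_sq.const_mul _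
  have hone : Integrable (fun z : ℝ × ℝ => 1 - t ^ 2 / 2 * (z.1 - z.2) ^ 2) (μ.prod μ) :=
    (integrable_const _).sub hsq
  have hfour : Integrable (fun z : ℝ × ℝ => 4 * t ^ 4 * (z.1 ^ 4 + z.2 ^ 4)) (μ.prod μ) :=
    (hfst.add hsnd).const_mul _
  calc ‖charFun μ t‖ ^ 2
      = ∫ z : ℝ × ℝ, Real.cos (inner ℝ z.1 t - inner ℝ z.2 t) ∂μ.prod μ := sq_norm_charFun μ t
    _ ≤ ∫ z : ℝ × ℝ, (1 - t ^ 2 / 2 * (z.1 - z.2) ^ 2 + 4 * t ^ 4 * (z.1 ^ 4 + z.2 ^ 4))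
          ∂μ.prod μ := by
        refine integral_mono (integrable_cos_inner_sub μ t) (hone.add hfour) fun z => ?_
        simpa [mul_sub] using cos_mul_sub_le t z.1 z.2
    _ = 1 - variance id μ * t ^ 2 + 8 * (∫ x, x ^ 4 ∂μ) * t ^ 4 := by
        rw [integral_add hone hfour, integral_sub (integrable_const _) hsq, integral_const_mul,
          integral_const_mul, integral_add hfst hsnd, integral_sub_sq_prod hμ2,
          integral_fun_fst (fun x => x ^ 4), integral_fun_snd (fun x => x ^ 4)]
        simp
        ring

lemma norm_charFun_le_exp (hμ : MemLp id 4 μ) (t : ℝ) :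
    ‖charFun μ t‖ ≤ Real.exp (-(variance id μ * t ^ 2 / 2) + 4 * (∫ x, x ^ 4 ∂μ) * t ^ 4) := by
  refine abs_le_of_sq_le_sq' ?_ (Real.exp_nonneg _) |>.2
  rw [← Real.exp_nat_mul]
  refine (sq_norm_charFun_le hμ t).trans (le_trans (le_of_eq ?_) (Real.add_one_le_exp _))
  push_cast
  ring

end Real

end CharFun

/-! ### Exponentially tilted laws -/

section Tilted

variable {Ω : Type*} [MeasurableSpace Ω] {P : Measure Ω} {X : Ω → ℝ}

/-- The conjugate (Esscher) law of `X`: its law under the probability measure proportional to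
`exp (s * X) • P`. Its characteristic function is the Laplace transform of `X` on the vertical line
of abscissa `s`, normalized to be `1` on the real axis. -/
def tiltedLaw (X : Ω → ℝ) (P : Measure Ω) (s : ℝ) : Measure ℝ := (P.tilted (s * X ·)).map X

lemma aemeasurable_tilted (hX : AEMeasurable X P) (s : ℝ) : AEMeasurable X (P.tilted (s * X ·)) :=
  hX.mono_ac (tilted_absolutelyContinuous _ _)

lemma isProbabilityMeasure_tiltedLaw [NeZero P] (hX : AEMeasurable X P) {s : ℝ}
    (hs : s ∈ integrableExpSet X P) : IsProbabilityMeasure (tiltedLaw X P s) :=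
  have := isProbabilityMeasure_tilted hs
  Measure.isProbabilityMeasure_map (aemeasurable_tilted hX s)

lemma charFun_tiltedLaw (hX : AEMeasurable X P) (s t : ℝ) :
    charFun (tiltedLaw X P s) t = complexMGF X P (s + t * Complex.I) / mgf X P s := by
  rw [tiltedLaw, ← complexMGF_mul_I (aemeasurable_tilted hX s), complexMGF,
    integral_tilted_mul_eq_mgf, complexMGF, ← integral_div]
  refine integral_congr_ae (ae_of_all _ fun ω => ?_)
  simp only [Complex.real_smul]
  push_cast
  rw [add_mul, Complex.exp_add]
  ring

lemma memLp_tiltedLaw {s : ℝ} (hs : s ∈ interior (integrableExpSet X P)) (p : NNReal) :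
    MemLp id p (tiltedLaw X P s) :=
  (memLp_map_measure_iff aestronglyMeasurable_id
    (aemeasurable_tilted (aemeasurable_of_mem_interior_integrableExpSet hs) s)).2
    (memLp_tilted_mul hs p)

lemma variance_tiltedLaw {s : ℝ} (hs : s ∈ interior (integrableExpSet X P)) :
    variance id (tiltedLaw X P s) = iteratedDeriv 2 (cgf X P) s := by
  rw [tiltedLaw, variance_id_map
    (aemeasurable_tilted (aemeasurable_of_mem_interior_integrableExpSet hs) s),
    variance_tilted_mul hs]

lemma integral_pow_tiltedLaw {s : ℝ} (hs : s ∈ interior (integrableExpSet X P)) (k : ℕ) :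
    ∫ x, x ^ k ∂tiltedLaw X P s = iteratedDeriv k (mgf X P) s / mgf X P s := by
  rw [tiltedLaw, integral_map
    (aemeasurable_tilted (aemeasurable_of_mem_interior_integrableExpSet hs) s)
    (by fun_prop : Measurable _).aestronglyMeasurable, integral_tilted_mul_eq_mgf,
    iteratedDeriv_mgf hs, ← integral_div]
  refine integral_congr_ae (ae_of_all _ fun ω => ?_)
  simp only [smul_eq_mul]
  ring

lemma eventually_mem_interior_integrableExpSet (h0 : 0 ∈ interior (integrableExpSet X P)) :
    ∀ᶠ s in 𝓝 (0 : ℝ), s ∈ interior (integrableExpSet X P) :=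
  isOpen_interior.mem_nhds h0

lemma exists_eventually_norm_charFun_tiltedLaw_le_exp [NeZero P]
    (h0 : 0 ∈ interior (integrableExpSet X P)) :
    ∃ C : ℝ, 0 < C ∧ ∀ᶠ s : ℝ in 𝓝 0, ∀ t : ℝ, ‖charFun (tiltedLaw X P s) t‖
      ≤ Real.exp (-(iteratedDeriv 2 (cgf X P) s * t ^ 2 / 2) + C * t ^ 4) := by
  have hmgf : mgf X P 0 ≠ 0 :=
    (mgf_pos' (NeZero.ne P) (integrable_of_mem_integrableExpSet (interior_subset h0))).ne'
  have hcont : ContinuousAt (fun s => iteratedDeriv 4 (mgf X P) s / mgf X P s) 0 :=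
    (analyticAt_iteratedDeriv_mgf h0 4).continuousAt.div (analyticAt_mgf h0).continuousAt hmgf
  obtain ⟨C, hC⟩ := exists_gt (iteratedDeriv 4 (mgf X P) 0 / mgf X P 0)
  refine ⟨4 * max C 1, by positivity, ?_⟩
  filter_upwards [hcont.eventually_lt_const hC, eventually_mem_interior_integrableExpSet h0]
    with s hsC hs t
  have := isProbabilityMeasure_tiltedLaw (aemeasurable_of_mem_interior_integrableExpSet hs)
    (interior_subset hs)
  refine (norm_charFun_le_exp (memLp_tiltedLaw hs 4) t).trans (Real.exp_le_exp.2 ?_)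
  rw [variance_tiltedLaw hs, integral_pow_tiltedLaw hs]
  gcongr
  exact hsC.le.trans (le_max_left _ _)

lemma exists_integrable_exp_mul_abs (h0 : 0 ∈ interior (integrableExpSet X P)) :
    ∃ b : ℝ, 0 < b ∧ Integrable (fun ω => Real.exp (b * |X ω|)) P := by
  obtain ⟨ε, hε, hball⟩ := Metric.mem_nhds_iff.1 (mem_interior_iff_mem_nhds.1 h0)
  have hmem : ∀ s : ℝ, |s| < ε → Integrable (fun ω => Real.exp (s * X ω)) P := fun s hs =>
    integrable_of_mem_integrableExpSet (hball (by simpa using hs))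
  have hhalf : |ε / 2| < ε := by rw [abs_of_pos (half_pos hε)]; exact half_lt_self hε
  exact ⟨ε / 2, half_pos hε, integrable_exp_mul_abs (hmem _ hhalf) (hmem _ (by rwa [abs_neg]))⟩

lemma tendsto_integral_abs_exp_sub_one (h0 : 0 ∈ interior (integrableExpSet X P)) :
    Tendsto (fun s => ∫ ω, |Real.exp (s * X ω) - 1| ∂P) (𝓝 0) (𝓝 0) := by
  obtain ⟨b, hb, hint⟩ := exists_integrable_exp_mul_abs h0
  have hX : AEMeasurable X P := aemeasurable_of_mem_interior_integrableExpSet h0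
  have hone : Integrable (fun _ => (1 : ℝ)) P := by
    simpa using integrable_of_mem_integrableExpSet (interior_subset h0)
  have hlim : ∀ ω, Tendsto (fun s => |Real.exp (s * X ω) - 1|) (𝓝 0) (𝓝 0) := fun ω => by
    have hcont : Continuous fun s => |Real.exp (s * X ω) - 1| := by fun_prop
    simpa using hcont.tendsto 0
  have hdom := tendsto_integral_filter_of_dominated_convergence (μ := P) _
    (Eventually.of_forall fun s => (by fun_prop : AEMeasurable
      (fun ω => |Real.exp (s * X ω) - 1|) P).aestronglyMeasurable)
    ?_ (hint.add hone) (ae_of_all _ hlim)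
  · simpa using hdom
  filter_upwards [Metric.ball_mem_nhds (0 : ℝ) hb] with s hs
  refine ae_of_all _ fun ω => ?_
  have hsb : |s| ≤ b := (by simpa using hs : |s| < b).le
  rw [Real.norm_eq_abs, abs_abs, Pi.add_apply]
  calc |Real.exp (s * X ω) - 1| ≤ |Real.exp (s * X ω)| + |1| := abs_sub _ _
    _ = Real.exp (s * X ω) + 1 := by rw [Real.abs_exp, abs_one]
    _ ≤ Real.exp (b * |X ω|) + 1 := by
      refine add_le_add_left (Real.exp_le_exp.2 ((le_abs_self _).trans ?_)) 1
      rw [abs_mul]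
      gcongr

lemma norm_complexMGF_sub_le [IsFiniteMeasure P] (hX : AEMeasurable X P) {s : ℝ}
    (hs : s ∈ integrableExpSet X P) (t : ℝ) :
    ‖complexMGF X P (s + t * Complex.I) - complexMGF X P (t * Complex.I)‖
      ≤ ∫ ω, |Real.exp (s * X ω) - 1| ∂P := by
  have hint : ∀ z : ℂ, z.re ∈ integrableExpSet X P →
      Integrable (fun ω => Complex.exp (z * X ω)) P := fun z hz =>
    integrable_cexp_mul_of_re_mem_integrableExpSet hX hz
  rw [complexMGF, complexMGF, ← integral_sub (hint _ (by simpa using hs))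
    (hint _ (by simp [integrableExpSet]))]
  refine (norm_integral_le_integral_norm _).trans_eq (integral_congr_ae (ae_of_all _ fun ω => ?_))
  have hfactor : Complex.exp ((s + t * Complex.I) * X ω) - Complex.exp (t * Complex.I * X ω)
      = Complex.exp ((t * X ω : ℝ) * Complex.I) * ((Real.exp (s * X ω) - 1 : ℝ) : ℂ) := by
    push_cast
    rw [mul_sub, ← Complex.exp_add, mul_one]
    ring_nf
  simp only [hfactor, norm_mul, Complex.norm_exp_ofReal_mul_I, one_mul, Complex.norm_real,
    Real.norm_eq_abs]

lemma exists_eventually_norm_charFun_tiltedLaw_le [IsProbabilityMeasure P]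
    (h0 : 0 ∈ interior (integrableExpSet X P))
    (hdecay : Tendsto (charFun (P.map X)) (Bornology.cobounded ℝ) (𝓝 0)) {ε : ℝ} (hε : 0 < ε) :
    ∃ ρ ∈ Set.Ioo (0 : ℝ) 1, ∀ᶠ s : ℝ in 𝓝 0, ∀ t : ℝ, ε ≤ |t| →
      ‖charFun (tiltedLaw X P s) t‖ ≤ ρ := by
  have hX : AEMeasurable X P := aemeasurable_of_mem_interior_integrableExpSet h0
  have := Measure.isProbabilityMeasure_map hX
  obtain ⟨ρ₀, ⟨hρ₀, hρ₀'⟩, hfar⟩ := exists_lt_one_forall_norm_charFun_le hdecay hε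
  obtain ⟨ρ, hρ, hρ'⟩ := exists_between hρ₀'
  have hlim : Tendsto (fun s => (ρ₀ + ∫ ω, |Real.exp (s * X ω) - 1| ∂P) / mgf X P s)
      (𝓝 0) (𝓝 ρ₀) := by
    simpa only [Pi.div_def, mgf_zero, add_zero, div_one] using
      ((tendsto_integral_abs_exp_sub_one h0).const_add ρ₀).div
        (analyticAt_mgf h0).continuousAt.tendsto (by simp)
  refine ⟨ρ, ⟨hρ₀.trans_lt hρ, hρ'⟩, ?_⟩
  filter_upwards [hlim.eventually_le_const hρ, eventually_mem_interior_integrableExpSet h0]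
    with s hsρ hs t ht
  have hs' := interior_subset hs
  have htri : ‖complexMGF X P (s + t * Complex.I)‖
      ≤ ρ₀ + ∫ ω, |Real.exp (s * X ω) - 1| ∂P := by
    rw [← sub_add_cancel (complexMGF X P (s + t * Complex.I)) (complexMGF X P (t * Complex.I)),
      add_comm ρ₀]
    refine (norm_add_le _ _).trans (add_le_add (norm_complexMGF_sub_le hX hs' t) ?_)
    rw [complexMGF_mul_I hX]
    exact hfar t ht
  rw [charFun_tiltedLaw hX, norm_div, Complex.norm_of_nonneg mgf_nonneg]
  exact (div_le_div_of_nonneg_right htri mgf_nonneg).trans hsρ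

end Tilted

/-! ### Laplace's method -/

section Laplace

lemma pow_le_gaussian_add {r v C t : ℝ} {n : ℕ} (hr₀ : 0 ≤ r) (hv : 0 < v) (hn : 1 ≤ n)
    (hr : r ≤ Real.exp (-(v * t ^ 2 / 2) + C * t ^ 4)) (hC : 0 ≤ C) (hCt : C * t ^ 2 ≤ v / 4) :
    r ^ n ≤ Real.exp (-(n * v / 2) * t ^ 2)
      + 128 * C / (n * v ^ 2) * Real.exp (-(n * v / 8) * t ^ 2) := by
  have : (0 : ℝ) < n := by exact_mod_cast hn
  let w : ℝ := n * v * t ^ 2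
  let u : ℝ := n * C * t ^ 4
  have hw : 0 ≤ w := by positivity
  have : 0 ≤ u := by positivity
  have huw : u ≤ w / 4 := by
    calc u = n * t ^ 2 * (C * t ^ 2) := by ring
      _ ≤ n * t ^ 2 * (v / 4) := by gcongr
      _ = w / 4 := by ring
  have hexp_u : Real.exp u ≤ 1 + u * Real.exp u := by
    have h := mul_le_mul_of_nonneg_right (Real.add_one_le_exp (-u)) (Real.exp_nonneg u)
    rw [← Real.exp_add, neg_add_cancel, Real.exp_zero] at h
    linarith
  have hw_sq : w ^ 2 ≤ 128 * Real.exp (w / 8) := by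
    have h := Real.quadratic_le_exp_of_nonneg (by positivity : 0 ≤ w / 8)
    nlinarith
  calc r ^ n ≤ Real.exp (-(v * t ^ 2 / 2) + C * t ^ 4) ^ n := pow_le_pow_left₀ hr₀ hr n
    _ = Real.exp (-(w / 2)) * Real.exp u := by
      rw [← Real.exp_nat_mul, ← Real.exp_add]
      congr 1
      ring
    _ ≤ Real.exp (-(w / 2)) * (1 + u * Real.exp u) := by gcongr
    _ = Real.exp (-(w / 2)) + C / (n * v ^ 2) * w ^ 2 * Real.exp (-(w / 2) + u) := by
      rw [Real.exp_add]
      simp only [w, u]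
      field_simp
    _ ≤ Real.exp (-(w / 2))
        + C / (n * v ^ 2) * (128 * Real.exp (w / 8)) * Real.exp (-(w / 2) + w / 4) := by gcongr
    _ = Real.exp (-(w / 2)) + 128 * C / (n * v ^ 2) * Real.exp (-(w / 8)) := by
      rw [show -(w / 8) = w / 8 + (-(w / 2) + w / 4) by ring, Real.exp_add (w / 8)]
      ring
    _ = _ := by
      simp only [w]
      ring_nf

variable {r : ℝ → ℝ} {C ε v ρ : ℝ} {k n : ℕ}

lemma pow_le_gaussian_add_mul_pow (hr₀ : ∀ t, 0 ≤ r t) (hv : 0 < v) (hC : 0 ≤ C)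
    (hCε : C * ε ^ 2 ≤ v / 4)
    (hnear : ∀ t, |t| < ε → r t ≤ Real.exp (-(v * t ^ 2 / 2) + C * t ^ 4))
    (hρ : 0 ≤ ρ) (hfar : ∀ t, ε ≤ |t| → r t ≤ ρ) (hn : 1 ≤ n) (hkn : k ≤ n) (t : ℝ) :
    r t ^ n ≤ Real.exp (-(n * v / 2) * t ^ 2)
      + 128 * C / (n * v ^ 2) * Real.exp (-(n * v / 8) * t ^ 2) + ρ ^ (n - k) * r t ^ k := by
  have hrk := pow_nonneg (hr₀ t) k
  rcases lt_or_ge |t| ε with ht | ht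
  · have hCt : C * t ^ 2 ≤ v / 4 := by
      rw [← sq_abs t]
      exact (by gcongr : C * |t| ^ 2 ≤ C * ε ^ 2).trans hCε
    exact (pow_le_gaussian_add (hr₀ t) hv hn (hnear t ht) hC hCt).trans
      (le_add_of_nonneg_right (by positivity))
  · calc r t ^ n = r t ^ (n - k) * r t ^ k := by rw [← pow_add, Nat.sub_add_cancel hkn]
      _ ≤ ρ ^ (n - k) * r t ^ k := by
        gcongr
        exacts [hr₀ t, hfar t ht]
      _ ≤ _ := le_add_of_nonneg_left (by positivity)

lemma integral_pow_le_gaussian_add (hr₀ : ∀ t, 0 ≤ r t) (hv : 0 < v) (hC : 0 ≤ C)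
    (hCε : C * ε ^ 2 ≤ v / 4)
    (hnear : ∀ t, |t| < ε → r t ≤ Real.exp (-(v * t ^ 2 / 2) + C * t ^ 4))
    (hρ : 0 ≤ ρ) (hfar : ∀ t, ε ≤ |t| → r t ≤ ρ) (hint : Integrable fun t => r t ^ k)
    (hn : 1 ≤ n) (hkn : k ≤ n) :
    ∫ t, r t ^ n ≤ √(2 * Real.pi / (n * v)) * (1 + 256 * C / (n * v ^ 2))
      + ρ ^ (n - k) * ∫ t, r t ^ k := by
  have : (0 : ℝ) < n := by exact_mod_cast hn
  have hg₁ := integrable_exp_neg_mul_sq (by positivity : 0 < n * v / 2)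
  have hg₂ := (integrable_exp_neg_mul_sq (by positivity : 0 < n * v / 8)).const_mul
    (128 * C / (n * v ^ 2))
  have hg₁₂ : Integrable fun t => Real.exp (-(n * v / 2) * t ^ 2)
      + 128 * C / (n * v ^ 2) * Real.exp (-(n * v / 8) * t ^ 2) := hg₁.add hg₂
  have hr := hint.const_mul (ρ ^ (n - k))
  refine (integral_mono_of_nonneg (ae_of_all _ fun t => pow_nonneg (hr₀ t) n) (hg₁₂.add hr)
    (ae_of_all _ (pow_le_gaussian_add_mul_pow hr₀ hv hC hCε hnear hρ hfar hn hkn))).trans_eq ?_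
  have hpi : Real.pi / (n * v / 8) = 2 ^ 2 * (2 * Real.pi / (n * v)) := by field_simp; norm_num
  rw [integral_add' hg₁₂ hr, integral_add hg₁ hg₂, integral_const_mul, integral_const_mul,
    integral_gaussian, integral_gaussian, hpi, Real.sqrt_mul (by positivity),
    Real.sqrt_sq two_pos.le, show Real.pi / (n * v / 2) = 2 * Real.pi / (n * v) by field_simp]
  ring

lemma exists_sq_mul_pow_sub_le (hρ : ρ ∈ Set.Ioo (0 : ℝ) 1) (k : ℕ) :
    ∃ D : ℝ, 0 ≤ D ∧ ∀ n : ℕ, k ≤ n → (n : ℝ) ^ 2 * ρ ^ (n - k) ≤ D := by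
  obtain ⟨D, hD⟩ := (tendsto_pow_const_mul_const_pow_of_abs_lt_one 2
    (by rw [abs_of_pos hρ.1]; exact hρ.2 : |ρ| < 1)).bddAbove_range
  have hD' (n : ℕ) : (n : ℝ) ^ 2 * ρ ^ n ≤ D := hD ⟨n, rfl⟩
  have hρk : 0 < ρ ^ k := pow_pos hρ.1 k
  have hD₀ : 0 ≤ D := by simpa using hD' 0
  refine ⟨D / ρ ^ k, by positivity, fun n hn => ?_⟩
  rw [le_div_iff₀ hρk, mul_assoc, ← pow_add, Nat.sub_add_cancel hn]
  exact hD' n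

lemma exists_sqrt_mul_integral_pow_le (hC : 0 ≤ C) {v₀ : ℝ} (hv₀ : 0 < v₀)
    (hCε : C * ε ^ 2 ≤ v₀ / 4) (hρ : ρ ∈ Set.Ioo (0 : ℝ) 1) (k : ℕ) {L : ℝ} (hL : 0 ≤ L) :
    ∃ A : ℝ, 0 ≤ A ∧ ∀ (r : ℝ → ℝ) (v : ℝ), v₀ ≤ v → (∀ t, 0 ≤ r t) →
      (∀ t, |t| < ε → r t ≤ Real.exp (-(v * t ^ 2 / 2) + C * t ^ 4)) →
      (∀ t, ε ≤ |t| → r t ≤ ρ) → Integrable (fun t => r t ^ k) → ∫ t, r t ^ k ≤ L →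
      ∀ n : ℕ, 1 ≤ n → k ≤ n →
        √(n / (2 * Real.pi)) * ∫ t, r t ^ n ≤ (√v)⁻¹ + A / n := by
  obtain ⟨D, hD₀, hD⟩ := exists_sq_mul_pow_sub_le hρ k
  refine ⟨(√v₀)⁻¹ * (256 * C / v₀ ^ 2) + D * L, by positivity,
    fun r v hv hr₀ hnear hfar hint hintL n hn hkn => ?_⟩
  have hn₁ : (1 : ℝ) ≤ n := by exact_mod_cast hn
  have hn₀ : (0 : ℝ) < n := one_pos.trans_le hn₁
  have hvpos : 0 < v := hv₀.trans_le hv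
  have hlead : √(n / (2 * Real.pi)) * √(2 * Real.pi / (n * v)) = (√v)⁻¹ := by
    rw [← Real.sqrt_mul (by positivity), ← Real.sqrt_inv]
    congr 1
    field_simp
  have htail : √(n / (2 * Real.pi)) * ρ ^ (n - k) ≤ D / n := by
    have hsqrt : √(n / (2 * Real.pi)) ≤ n := by
      rw [Real.sqrt_le_left hn₀.le, div_le_iff₀ (by positivity)]
      nlinarith [Real.pi_gt_three]
    have hρn : 0 ≤ ρ ^ (n - k) := pow_nonneg hρ.1.le _
    rw [le_div_iff₀ hn₀]
    calc √(n / (2 * Real.pi)) * ρ ^ (n - k) * n ≤ n * ρ ^ (n - k) * n := by gcongr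
      _ = (n : ℝ) ^ 2 * ρ ^ (n - k) := by ring
      _ ≤ D := hD n hkn
  calc √(n / (2 * Real.pi)) * ∫ t, r t ^ n
      ≤ √(n / (2 * Real.pi)) * (√(2 * Real.pi / (n * v)) * (1 + 256 * C / (n * v ^ 2))
        + ρ ^ (n - k) * ∫ t, r t ^ k) := by
        gcongr
        exact integral_pow_le_gaussian_add hr₀ hvpos hC (hCε.trans (by gcongr)) hnear hρ.1.le
          hfar hint hn hkn
    _ = √(n / (2 * Real.pi)) * √(2 * Real.pi / (n * v)) * (1 + 256 * C / (n * v ^ 2))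
        + √(n / (2 * Real.pi)) * ρ ^ (n - k) * ∫ t, r t ^ k := by ring
    _ ≤ (√v)⁻¹ * (1 + 256 * C / (n * v ^ 2)) + D / n * L := by
      rw [hlead]
      gcongr
      exact integral_nonneg fun t => pow_nonneg (hr₀ t) k
    _ = (√v)⁻¹ + ((√v)⁻¹ * (256 * C / v ^ 2) + D * L) / n := by field_simp; ring
    _ ≤ _ := by gcongr

end Laplace

/-! ### The saddlepoint bound -/

section Saddlepoint

lemma analyticAt_iteratedDeriv {f : ℝ → ℝ} {x : ℝ} (hf : AnalyticAt ℝ f x) (k : ℕ) :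
    AnalyticAt ℝ (iteratedDeriv k f) x := by
  rw [iteratedDeriv_eq_iterate]
  exact hf.iterated_deriv k

lemma IsDensity.tendsto_charFun_map {Ω : Type*} [MeasurableSpace Ω] {P : Measure Ω} {Y : Ω → ℝ}
    {p : ℝ → ℝ} (hp : IsDensity p Y P) :
    Tendsto (charFun (P.map Y)) (Bornology.cobounded ℝ) (𝓝 0) := by
  have hpi : -(2 * Real.pi) ≠ 0 := neg_ne_zero.2 Real.two_pi_pos.ne'
  have hfourier : Tendsto (𝓕 (expTilt p 0)) (Bornology.cobounded ℝ) (𝓝 0) := by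
    rw [Metric.cobounded_eq_cocompact]
    exact Real.zero_at_infty_fourier _
  refine (hfourier.comp (tendsto_mul_left_cobounded (inv_ne_zero hpi))).congr fun t => ?_
  rw [hp.fourier_expTilt, Function.comp_apply, mul_inv_cancel_left₀ hpi, Complex.ofReal_zero,
    zero_add, complexMGF_mul_I hp.hasLaw.aemeasurable]

variable {Ω Ω' : Type*} [MeasurableSpace Ω] [MeasurableSpace Ω'] {P : Measure Ω}
  {P' : Measure Ω'} {X : Ω → ℝ} {ξ : ℕ → Ω' → ℝ} {p : ℝ → ℝ} {k n : ℕ}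

lemma charFun_map_normalizedSum (hindep : iIndepFun ξ P')
    (hident : ∀ i, IdentDistrib (ξ i) X P' P) (n : ℕ) (t : ℝ) :
    charFun (P'.map (normalizedSum ξ n)) t = charFun (P.map X) (t / √(n : ℝ)) ^ n := by
  rw [← complexMGF_mul_I (aemeasurable_normalizedSum (fun i => (hident i).aemeasurable_fst) n),
    ← complexMGF_mul_I (hident 0).aemeasurable_snd, complexMGF_normalizedSum hindep hident]
  push_cast
  ring_nf

lemma tendsto_charFun_map_of_isDensity_normalizedSum (hindep : iIndepFun ξ P')
    (hident : ∀ i, IdentDistrib (ξ i) X P' P) (hn : 1 ≤ n)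
    (hp : IsDensity p (normalizedSum ξ n) P') :
    Tendsto (charFun (P.map X)) (Bornology.cobounded ℝ) (𝓝 0) := by
  have hsqrt : √(n : ℝ) ≠ 0 := by positivity
  have hpow : Tendsto (fun t => charFun (P.map X) t ^ n) (Bornology.cobounded ℝ) (𝓝 0) := by
    refine (hp.tendsto_charFun_map.comp (tendsto_mul_left_cobounded hsqrt)).congr fun t => ?_
    rw [Function.comp_apply, charFun_map_normalizedSum hindep hident, mul_div_cancel_left₀ _ hsqrt]
  have hroot := (tendsto_zero_iff_norm_tendsto_zero.1 hpow).rpow_const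
    (p := (n : ℝ)⁻¹) (Or.inr (by positivity))
  rw [Real.zero_rpow (by positivity)] at hroot
  refine tendsto_zero_iff_norm_tendsto_zero.2 (hroot.congr fun t => ?_)
  rw [norm_pow, Real.pow_rpow_inv_natCast (norm_nonneg _) (by omega)]

lemma mgf_normalizedSum (hindep : iIndepFun ξ P') (hident : ∀ i, IdentDistrib (ξ i) X P' P)
    (n : ℕ) (a : ℝ) : mgf (normalizedSum ξ n) P' a = mgf X P (a / √(n : ℝ)) ^ n := by
  have h := complexMGF_normalizedSum hindep hident n a
  rw [← Complex.ofReal_div, complexMGF_ofReal, complexMGF_ofReal] at h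
  exact_mod_cast h

lemma complexMGF_normalizedSum_add_mul_I [NeZero P] (hindep : iIndepFun ξ P')
    (hident : ∀ i, IdentDistrib (ξ i) X P' P) (hn : 1 ≤ n) {s : ℝ}
    (hs : s ∈ integrableExpSet X P) (t : ℝ) :
    complexMGF (normalizedSum ξ n) P' ((√(n : ℝ) * s : ℝ) + t * Complex.I)
      = (mgf X P s * charFun (tiltedLaw X P s) (t / √(n : ℝ))) ^ n := by
  have hsqrt : ((√(n : ℝ) : ℝ) : ℂ) ≠ 0 := by
    have : √(n : ℝ) ≠ 0 := by positivity
    exact_mod_cast this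
  have hmgf : (mgf X P s : ℂ) ≠ 0 := by
    exact_mod_cast (mgf_pos' (NeZero.ne P) hs).ne'
  rw [charFun_tiltedLaw (hident 0).aemeasurable_snd, mul_div_cancel₀ _ hmgf,
    complexMGF_normalizedSum hindep hident]
  congr 2
  push_cast
  field_simp

lemma norm_complexMGF_normalizedSum_add_mul_I [NeZero P] (hindep : iIndepFun ξ P')
    (hident : ∀ i, IdentDistrib (ξ i) X P' P) (hn : 1 ≤ n) {s : ℝ}
    (hs : s ∈ integrableExpSet X P) (t : ℝ) :
    ‖complexMGF (normalizedSum ξ n) P' ((√(n : ℝ) * s : ℝ) + t * Complex.I)‖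
      = mgf X P s ^ n * ‖charFun (tiltedLaw X P s) (t / √(n : ℝ))‖ ^ n := by
  rw [complexMGF_normalizedSum_add_mul_I hindep hident hn hs, norm_pow, norm_mul,
    Complex.norm_of_nonneg mgf_nonneg, mul_pow]

lemma integrable_complexMGF_normalizedSum [NeZero P] (hindep : iIndepFun ξ P')
    (hident : ∀ i, IdentDistrib (ξ i) X P' P) (hn : 1 ≤ n) {s : ℝ}
    (hs : s ∈ integrableExpSet X P)
    (hint : Integrable fun t => ‖charFun (tiltedLaw X P s) t‖ ^ n) :
    Integrable fun t : ℝ =>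
      complexMGF (normalizedSum ξ n) P' ((√(n : ℝ) * s : ℝ) + t * Complex.I) := by
  have := isProbabilityMeasure_tiltedLaw (hident 0).aemeasurable_snd hs
  simp only [complexMGF_normalizedSum_add_mul_I hindep hident hn hs, mul_pow]
  refine Integrable.const_mul (Integrable.comp_div (g := fun t => charFun (tiltedLaw X P s) t ^ n)
    ?_ (by positivity)) _
  refine (integrable_norm_iff ((continuous_charFun).pow n).aestronglyMeasurable).1 ?_
  simpa only [Pi.pow_apply, norm_pow] using hint

lemma integral_norm_complexMGF_normalizedSum_pow [NeZero P] (hindep : iIndepFun ξ P')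
    (hident : ∀ i, IdentDistrib (ξ i) X P' P) (hn : 1 ≤ n) {s : ℝ}
    (hs : s ∈ integrableExpSet X P) (j : ℕ) :
    ∫ t : ℝ, ‖complexMGF (normalizedSum ξ n) P' ((√(n : ℝ) * s : ℝ) + t * Complex.I)‖ ^ j
      = mgf X P s ^ (n * j) * (√(n : ℝ) * ∫ t, ‖charFun (tiltedLaw X P s) t‖ ^ (n * j)) := by
  simp only [norm_complexMGF_normalizedSum_add_mul_I hindep hident hn hs, mul_pow, ← pow_mul]
  rw [integral_const_mul, Measure.integral_comp_div
    (fun t => ‖charFun (tiltedLaw X P s) t‖ ^ (n * j)), abs_of_nonneg (Real.sqrt_nonneg _),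
    smul_eq_mul]

lemma integrable_norm_charFun_tiltedLaw_pow [NeZero P] (hindep : iIndepFun ξ P')
    (hident : ∀ i, IdentDistrib (ξ i) X P' P) (hn : 1 ≤ n)
    (hp : IsDensity p (normalizedSum ξ n) P') (hb : IsBoundedAbove p) {s : ℝ}
    (hs : s ∈ integrableExpSet X P) (hs2 : 2 * s ∈ integrableExpSet X P) :
    Integrable fun t => ‖charFun (tiltedLaw X P s) t‖ ^ (n * 2) := by
  have hsqrt : √(n : ℝ) ≠ 0 := by positivity
  have hmgf : mgf X P s ≠ 0 := (mgf_pos' (NeZero.ne P) hs).ne'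
  have h := hp.integrable_norm_complexMGF_sq hb (a := √(n : ℝ) * s)
    (mem_integrableExpSet_normalizedSum hindep hident n (by rwa [mul_div_cancel_left₀ _ hsqrt]))
    (mem_integrableExpSet_normalizedSum hindep hident n
      (by rwa [mul_left_comm, mul_div_cancel_left₀ _ hsqrt]))
  simp only [norm_complexMGF_normalizedSum_add_mul_I hindep hident hn hs, mul_pow,
    ← pow_mul] at h
  rw [integrable_const_mul_iff (by simpa using pow_ne_zero _ hmgf)] at h
  simpa [hsqrt] using h.comp_mul_right' hsqrt

lemma integrable_norm_charFun_pow_of_le {ν : Measure ℝ} [IsProbabilityMeasure ν] (hkn : k ≤ n)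
    (hint : Integrable fun t => ‖charFun ν t‖ ^ k) : Integrable fun t => ‖charFun ν t‖ ^ n := by
  refine hint.mono' ((continuous_charFun.norm).pow n).aestronglyMeasurable (ae_of_all _ fun t => ?_)
  rw [Real.norm_of_nonneg (by positivity)]
  exact pow_le_pow_of_le_one (norm_nonneg _) (norm_charFun_le_one t) hkn

lemma exists_continuous_isDensity_normalizedSum [IsProbabilityMeasure P]
    (hindep : iIndepFun ξ P') (hident : ∀ i, IdentDistrib (ξ i) X P' P) (hk : 1 ≤ k)
    (hp : IsDensity p (normalizedSum ξ k) P') (hb : IsBoundedAbove p) (hkn : 2 * k ≤ n) :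
    ∃ q : ℝ → ℝ, Continuous q ∧ IsBoundedAbove q ∧ IsDensity q (normalizedSum ξ n) P' := by
  have := hindep.isProbabilityMeasure
  have h0 : 0 ∈ integrableExpSet X P := by simp [integrableExpSet]
  have := isProbabilityMeasure_tiltedLaw (hident 0).aemeasurable_snd h0
  have hm : ∀ i, AEMeasurable (ξ i) P' := fun i => (hident i).aemeasurable_fst
  have hint := integrable_norm_charFun_pow_of_le (by omega : k * 2 ≤ n)
    (integrable_norm_charFun_tiltedLaw_pow hindep hident hk hp hb h0 (by simpa using h0))
  refine exists_continuous_isDensity (aemeasurable_normalizedSum hm n)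
    (absolutelyContinuous_map_normalizedSum hindep hm hk (by omega) hp.absolutelyContinuous) ?_
  simpa using integrable_complexMGF_normalizedSum hindep hident (by omega) h0 hint

lemma integral_norm_charFun_tiltedLaw_pow_le [NeZero P] (hindep : iIndepFun ξ P')
    (hident : ∀ i, IdentDistrib (ξ i) X P' P) (hn : 1 ≤ n)
    (hp : IsDensity p (normalizedSum ξ n) P') {B : ℝ} (hB : ∀ y, p y ≤ B) {s : ℝ}
    (hs : s ∈ integrableExpSet X P) (hs2 : 2 * s ∈ integrableExpSet X P) :
    ∫ t, ‖charFun (tiltedLaw X P s) t‖ ^ (n * 2)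
      ≤ 2 * Real.pi * (B * mgf X P (2 * s) ^ n) / (√(n : ℝ) * mgf X P s ^ (n * 2)) := by
  have hsqrt : 0 < √(n : ℝ) := by positivity
  have hmgf : 0 < mgf X P s := mgf_pos' (NeZero.ne P) hs
  have h := hp.integral_norm_complexMGF_sq_le hB (a := √(n : ℝ) * s)
    (mem_integrableExpSet_normalizedSum hindep hident n
      (by rwa [mul_div_cancel_left₀ _ hsqrt.ne']))
    (mem_integrableExpSet_normalizedSum hindep hident n
      (by rwa [mul_left_comm, mul_div_cancel_left₀ _ hsqrt.ne']))
  rw [integral_norm_complexMGF_normalizedSum_pow hindep hident hn hs,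
    mgf_normalizedSum hindep hident, mul_left_comm 2, mul_div_cancel_left₀ _ hsqrt.ne'] at h
  rw [le_div_iff₀ (by positivity)]
  linarith

lemma exists_eventually_integral_norm_charFun_tiltedLaw_pow_le [NeZero P]
    (h0 : 0 ∈ interior (integrableExpSet X P)) (hindep : iIndepFun ξ P')
    (hident : ∀ i, IdentDistrib (ξ i) X P' P) (hn : 1 ≤ n)
    (hp : IsDensity p (normalizedSum ξ n) P') (hb : IsBoundedAbove p) :
    ∃ L : ℝ, 0 ≤ L ∧ ∀ᶠ s : ℝ in 𝓝 0,
      Integrable (fun t => ‖charFun (tiltedLaw X P s) t‖ ^ (n * 2)) ∧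
        ∫ t, ‖charFun (tiltedLaw X P s) t‖ ^ (n * 2) ≤ L := by
  obtain ⟨B, hB⟩ := hb
  let R (s : ℝ) := 2 * Real.pi * (B * mgf X P (2 * s) ^ n) / (√(n : ℝ) * mgf X P s ^ (n * 2))
  have htwo : Tendsto (fun s : ℝ => 2 * s) (𝓝 0) (𝓝 0) := by
    simpa using (continuous_const_mul (2 : ℝ)).tendsto 0
  have hR : ContinuousAt R 0 := by
    have hcont := (analyticAt_mgf h0).continuousAt
    have hcont2 : ContinuousAt (fun s => mgf X P (2 * s)) 0 :=
      ContinuousAt.comp_of_eq (g := mgf X P) hcont (continuous_const_mul (2 : ℝ)).continuousAt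
        (mul_zero 2)
    have h0' : 0 ∈ integrableExpSet X P := interior_subset h0
    have hmgf : 0 < mgf X P 0 := mgf_pos' (NeZero.ne P) h0'
    exact (continuousAt_const.mul (continuousAt_const.mul (hcont2.pow n))).div
      (continuousAt_const.mul (hcont.pow _)) (by positivity)
  obtain ⟨L, hL⟩ := exists_gt (R 0)
  have hnear := eventually_mem_interior_integrableExpSet h0
  refine ⟨max L 0, le_max_right _ _, ?_⟩
  filter_upwards [hR.eventually_lt_const hL, hnear, htwo.eventually hnear] with s hsL hs hs2
  exact ⟨integrable_norm_charFun_tiltedLaw_pow hindep hident hn hp ⟨B, hB⟩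
      (interior_subset hs) (interior_subset hs2),
    (integral_norm_charFun_tiltedLaw_pow_le hindep hident hn hp hB (interior_subset hs)
      (interior_subset hs2)).trans (hsL.le.trans (le_max_left _ _))⟩

lemma IsDensity.mul_exp_le_integral_norm_charFun_tiltedLaw [NeZero P] (hindep : iIndepFun ξ P')
    (hident : ∀ i, IdentDistrib (ξ i) X P' P) (hn : 1 ≤ n)
    (hp : IsDensity p (normalizedSum ξ n) P') (hc : Continuous p) {s : ℝ}
    (hs : s ∈ integrableExpSet X P)
    (hint : Integrable fun t => ‖charFun (tiltedLaw X P s) t‖ ^ n) (x : ℝ) :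
    p x * Real.exp (√(n : ℝ) * s * x) ≤ (√(2 * Real.pi))⁻¹ * Real.exp (n * cgf X P s)
      * (√(n / (2 * Real.pi)) * ∫ t, ‖charFun (tiltedLaw X P s) t‖ ^ n) := by
  have hsqrt : 0 < √(n : ℝ) := by positivity
  have hconst : (2 * Real.pi)⁻¹ * √(n : ℝ) = (√(2 * Real.pi))⁻¹ * √(n / (2 * Real.pi)) := by
    rw [Real.sqrt_div (Nat.cast_nonneg n), div_eq_mul_inv, mul_left_comm, ← mul_inv,
      Real.mul_self_sqrt (by positivity), mul_comm]
  have hnorm := integral_norm_complexMGF_normalizedSum_pow hindep hident hn hs 1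
  simp only [pow_one, mul_one] at hnorm
  refine (hp.mul_exp_le_integral_norm_complexMGF hc
    (mem_integrableExpSet_normalizedSum hindep hident n
      (by rwa [mul_div_cancel_left₀ _ hsqrt.ne']))
    (integrable_complexMGF_normalizedSum hindep hident hn hs hint) x).trans_eq ?_
  rw [hnorm, ← exp_cgf hs, ← Real.exp_nat_mul]
  linear_combination (Real.exp (n * cgf X P s)
    * ∫ t, ‖charFun (tiltedLaw X P s) t‖ ^ n) * hconst

lemma IsDensity.div_gaussianPDFReal_le [NeZero P] (hindep : iIndepFun ξ P')
    (hident : ∀ i, IdentDistrib (ξ i) X P' P) (hn : 1 ≤ n)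
    (hp : IsDensity p (normalizedSum ξ n) P') (hc : Continuous p) {s : ℝ}
    (hs : s ∈ integrableExpSet X P)
    (hint : Integrable fun t => ‖charFun (tiltedLaw X P s) t‖ ^ n) (μ : ℝ) :
    p (√(n : ℝ) * μ) / gaussianPDFReal 0 1 (√(n : ℝ) * μ)
      ≤ Real.exp (-(n * (s * μ - cgf X P s - μ ^ 2 / 2)))
        * (√(n / (2 * Real.pi)) * ∫ t, ‖charFun (tiltedLaw X P s) t‖ ^ n) := by
  have hgauss : gaussianPDFReal 0 1 (√(n : ℝ) * μ)
      = (√(2 * Real.pi))⁻¹ * Real.exp (-(n * μ ^ 2 / 2)) := by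
    simp only [gaussianPDFReal, NNReal.coe_one, mul_one, sub_zero, mul_pow,
      Real.sq_sqrt (Nat.cast_nonneg n), neg_div]
  have hexp : Real.exp (-(n * (s * μ - cgf X P s - μ ^ 2 / 2))) * Real.exp (-(n * μ ^ 2 / 2))
      = Real.exp (n * cgf X P s) / Real.exp (√(n : ℝ) * s * (√(n : ℝ) * μ)) := by
    rw [← Real.exp_add, ← Real.exp_sub]
    congr 1
    linear_combination s * μ * Real.mul_self_sqrt (Nat.cast_nonneg n)
  rw [hgauss, div_le_iff₀ (by positivity)]
  refine ((le_div_iff₀ (Real.exp_pos _)).2 (hp.mul_exp_le_integral_norm_charFun_tiltedLaw hindep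
    hident hn hc hs hint _)).trans_eq ?_
  linear_combination (-(√(2 * Real.pi))⁻¹ * (√(n / (2 * Real.pi))
    * ∫ t, ‖charFun (tiltedLaw X P s) t‖ ^ n)) * hexp

lemma exists_eventually_sqrt_mul_integral_norm_charFun_tiltedLaw_pow_le [IsProbabilityMeasure P]
    (h0 : 0 ∈ interior (integrableExpSet X P)) (hvar : 0 < iteratedDeriv 2 (cgf X P) 0)
    (hdecay : Tendsto (charFun (P.map X)) (Bornology.cobounded ℝ) (𝓝 0)) {L : ℝ} (hL₀ : 0 ≤ L)
    (hL : ∀ᶠ s : ℝ in 𝓝 0, Integrable (fun t => ‖charFun (tiltedLaw X P s) t‖ ^ k) ∧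
      ∫ t, ‖charFun (tiltedLaw X P s) t‖ ^ k ≤ L) :
    ∃ A : ℝ, 0 ≤ A ∧ ∀ᶠ s : ℝ in 𝓝 0, ∀ n : ℕ, 1 ≤ n → k ≤ n →
      √(n / (2 * Real.pi)) * ∫ t, ‖charFun (tiltedLaw X P s) t‖ ^ n
        ≤ (√(iteratedDeriv 2 (cgf X P) s))⁻¹ + A / n := by
  let v₀ := iteratedDeriv 2 (cgf X P) 0 / 2
  obtain ⟨C, hC, hnear⟩ := exists_eventually_norm_charFun_tiltedLaw_le_exp h0
  let ε := √(v₀ / (4 * C))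
  have hε : 0 < ε := by positivity
  have hCε : C * ε ^ 2 ≤ v₀ / 4 := by
    rw [Real.sq_sqrt (by positivity)]
    exact le_of_eq (by field_simp)
  obtain ⟨ρ, hρ, hfar⟩ := exists_eventually_norm_charFun_tiltedLaw_le h0 hdecay hε
  obtain ⟨A, hA, hlaplace⟩ := exists_sqrt_mul_integral_pow_le hC.le (by positivity) hCε hρ k hL₀
  have hvar_near : ∀ᶠ s in 𝓝 (0 : ℝ), v₀ < iteratedDeriv 2 (cgf X P) s :=
    (analyticAt_iteratedDeriv (analyticAt_cgf h0) 2).continuousAt.eventually_const_lt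
      (half_lt_self hvar)
  refine ⟨A, hA, ?_⟩
  filter_upwards [hnear, hfar, hvar_near, hL] with s hnear hfar hvar_near hL n hn hkn
  exact hlaplace _ _ hvar_near.le (fun t => norm_nonneg _) (fun t _ => hnear t) hfar hL.1 hL.2
    n hn hkn

lemma exists_eventually_div_gaussianPDFReal_le [IsProbabilityMeasure P]
    (h0 : 0 ∈ interior (integrableExpSet X P)) (hvar : 0 < iteratedDeriv 2 (cgf X P) 0)
    (hindep : iIndepFun ξ P') (hident : ∀ i, IdentDistrib (ξ i) X P' P) (hk : 1 ≤ k)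
    (hp : IsDensity p (normalizedSum ξ k) P') (hb : IsBoundedAbove p) :
    ∃ A : ℝ, 0 ≤ A ∧ ∀ᶠ s : ℝ in 𝓝 0, ∀ n : ℕ, 2 * k ≤ n →
      ∀ q : ℝ → ℝ, Continuous q → IsDensity q (normalizedSum ξ n) P' → ∀ μ : ℝ,
        q (√(n : ℝ) * μ) / gaussianPDFReal 0 1 (√(n : ℝ) * μ)
          ≤ Real.exp (-(n * (s * μ - cgf X P s - μ ^ 2 / 2)))
            * ((√(iteratedDeriv 2 (cgf X P) s))⁻¹ + A / n) := by
  obtain ⟨L, hL₀, hL⟩ :=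
    exists_eventually_integral_norm_charFun_tiltedLaw_pow_le h0 hindep hident hk hp hb
  obtain ⟨A, hA, hlaplace⟩ := exists_eventually_sqrt_mul_integral_norm_charFun_tiltedLaw_pow_le h0
    hvar (tendsto_charFun_map_of_isDensity_normalizedSum hindep hident hk hp) hL₀ hL
  refine ⟨A, hA, ?_⟩
  filter_upwards [hL, hlaplace, eventually_mem_interior_integrableExpSet h0]
    with s hL hlaplace hs n hn q hqc hq μ
  have hs' := interior_subset hs
  have := isProbabilityMeasure_tiltedLaw (hident 0).aemeasurable_snd hs'
  have hint := integrable_norm_charFun_pow_of_le (by omega : k * 2 ≤ n) hL.1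
  refine (hq.div_gaussianPDFReal_le hindep hident (by omega) hqc hs' hint μ).trans ?_
  gcongr
  exact hlaplace n (by omega) (by omega)

end Saddlepoint

/-! ### Expansion of the exponent and of the variance -/

section Expansion

open Asymptotics

variable {f K : ℝ → ℝ} {m : ℕ}

lemma isBigO_sub_taylor (hf : AnalyticAt ℝ f 0) (N : ℕ) :
    (fun s => f s - ∑ k ∈ Finset.range N, iteratedDeriv k f 0 / k.factorial * s ^ k)
      =O[𝓝 0] fun s => s ^ N := by
  refine IsBigO.of_norm_right ?_
  simpa [FormalMultilinearSeries.partialSum, FormalMultilinearSeries.ofScalars, mul_comm]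
    using hf.hasFPowerSeriesAt.isBigO_sub_partialSum_pow N

lemma isBigO_pow_of_iteratedDeriv_eq_zero (hf : AnalyticAt ℝ f 0)
    (hzero : ∀ k < m, iteratedDeriv k f 0 = 0) : f =O[𝓝 0] fun s => s ^ m := by
  refine (isBigO_sub_taylor hf m).congr_left fun s => ?_
  rw [Finset.sum_eq_zero fun k hk => by simp [hzero k (Finset.mem_range.1 hk)], sub_zero]

lemma isLittleO_sub_pow_of_iteratedDeriv_eq_zero (hf : AnalyticAt ℝ f 0)
    (hzero : ∀ k < m, iteratedDeriv k f 0 = 0) :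
    (fun s => f s - iteratedDeriv m f 0 / m.factorial * s ^ m) =o[𝓝 0] fun s => s ^ m := by
  refine ((isBigO_sub_taylor hf (m + 1)).trans_isLittleO
    (isLittleO_pow_pow m.lt_succ_self)).congr_left fun s => ?_
  rw [Finset.sum_range_succ,
    Finset.sum_eq_zero fun k hk => by simp [hzero k (Finset.mem_range.1 hk)], zero_add]

lemma isBigO_deriv_pow_of_iteratedDeriv_eq_zero (hf : AnalyticAt ℝ f 0)
    (hzero : ∀ k < m, iteratedDeriv k f 0 = 0) : deriv f =O[𝓝 0] fun s => s ^ (m - 1) :=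
  isBigO_pow_of_iteratedDeriv_eq_zero hf.deriv fun k hk => by
    rw [← iteratedDeriv_succ', hzero (k + 1) (by omega)]

lemma exists_eventually_pow_le_neg_sub_sq_deriv (hf : AnalyticAt ℝ f 0) (hm : 3 ≤ m)
    (hmeven : Even m) (hzero : ∀ k < m, iteratedDeriv k f 0 = 0)
    (hneg : iteratedDeriv m f 0 < 0) :
    ∃ c : ℝ, 0 < c ∧ ∀ᶠ s in 𝓝 0, c * s ^ m ≤ -f s - deriv f s ^ 2 / 2 := by
  let γ := -(iteratedDeriv m f 0 / m.factorial)
  have hγ : 0 < γ := neg_pos.2 (div_neg_of_neg_of_pos hneg (by positivity))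
  have hsq : (fun s => deriv f s ^ 2) =o[𝓝 0] fun s => s ^ m := by
    refine ((isBigO_deriv_pow_of_iteratedDeriv_eq_zero hf hzero).pow 2).trans_isLittleO ?_
    simp only [← pow_mul]
    exact isLittleO_pow_pow (by omega)
  have hrem := (isLittleO_sub_pow_of_iteratedDeriv_eq_zero hf hzero).add (hsq.const_mul_left 2⁻¹)
  refine ⟨γ / 2, half_pos hγ, (hrem.def (half_pos hγ)).mono fun s hs => ?_⟩
  rw [Real.norm_of_nonneg (hmeven.pow_nonneg s)] at hs
  linear_combination (Real.le_norm_self _).trans hs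

lemma iteratedDeriv_sub_sq_div_two (hK : AnalyticAt ℝ K 0) (k : ℕ) :
    iteratedDeriv k (fun s => K s - s ^ 2 / 2) 0
      = iteratedDeriv k K 0 - if k = 2 then 1 else 0 := by
  have hsq : iteratedDeriv k (fun s : ℝ => s ^ 2 / 2) 0 = if k = 2 then 1 else 0 := by
    rw [iteratedDeriv_div_const, iteratedDeriv_fun_pow_zero]
    split_ifs <;> simp_all
  have := iteratedDeriv_fun_sub (n := k) hK.contDiffAt
    (by fun_prop : ContDiffAt ℝ k (fun s : ℝ => s ^ 2 / 2) 0)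
  rw [this, hsq]

lemma eventually_deriv_sub_sq_div_two (hK : AnalyticAt ℝ K 0) :
    deriv (fun s => K s - s ^ 2 / 2) =ᶠ[𝓝 0] fun s => deriv K s - s := by
  filter_upwards [hK.eventually_analyticAt] with s hs
  have hsq : HasDerivAt (fun s : ℝ => s ^ 2 / 2) s s := by
    simpa using (hasDerivAt_pow 2 s).div_const 2
  exact (hs.differentiableAt.hasDerivAt.sub hsq).deriv

lemma eventually_deriv_deriv_sub_sq_div_two (hK : AnalyticAt ℝ K 0) :
    deriv (deriv fun s => K s - s ^ 2 / 2) =ᶠ[𝓝 0] fun s => iteratedDeriv 2 K s - 1 := by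
  refine (eventually_deriv_sub_sq_div_two hK).deriv.trans ?_
  filter_upwards [hK.deriv.eventually_analyticAt] with s hs
  rw [iteratedDeriv_succ, iteratedDeriv_one]
  exact (hs.differentiableAt.hasDerivAt.sub (hasDerivAt_id s)).deriv

lemma exists_eventually_pow_le_legendre (hK : AnalyticAt ℝ K 0) (hm : 3 ≤ m) (hmeven : Even m)
    (hzero : ∀ k < m, iteratedDeriv k K 0 = if k = 2 then 1 else 0)
    (hneg : iteratedDeriv m K 0 < 0) :
    ∃ c : ℝ, 0 < c ∧ ∀ᶠ s in 𝓝 0, c * s ^ m ≤ s * deriv K s - K s - deriv K s ^ 2 / 2 := by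
  have hf : AnalyticAt ℝ (fun s => K s - s ^ 2 / 2) 0 := by fun_prop
  obtain ⟨c, hc, h⟩ := exists_eventually_pow_le_neg_sub_sq_deriv hf hm hmeven
    (fun k hk => by rw [iteratedDeriv_sub_sq_div_two hK, hzero k hk, sub_self])
    (by rwa [iteratedDeriv_sub_sq_div_two hK, if_neg (by omega), sub_zero])
  refine ⟨c, hc, ?_⟩
  filter_upwards [h, eventually_deriv_sub_sq_div_two hK] with s hs hderiv
  rw [hderiv] at hs
  linear_combination hs

lemma exists_eventually_abs_iteratedDeriv_two_sub_one_le (hK : AnalyticAt ℝ K 0)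
    (hzero : ∀ k < m, iteratedDeriv k K 0 = if k = 2 then 1 else 0) :
    ∃ D : ℝ, 0 < D ∧ ∀ᶠ s in 𝓝 0, |iteratedDeriv 2 K s - 1| ≤ D * |s| ^ (m - 2) := by
  have hf : AnalyticAt ℝ (fun s => K s - s ^ 2 / 2) 0 := by fun_prop
  have hbigO := isBigO_deriv_pow_of_iteratedDeriv_eq_zero (m := m - 1) hf.deriv fun k hk => by
    rw [← iteratedDeriv_succ', iteratedDeriv_sub_sq_div_two hK, hzero _ (by omega), sub_self]
  obtain ⟨D, hD, h⟩ := (hbigO.congr' (eventually_deriv_deriv_sub_sq_div_two hK)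
    .rfl).exists_pos
  refine ⟨D, hD, h.bound.mono fun s hs => ?_⟩
  simpa only [Real.norm_eq_abs, abs_pow, Nat.sub_sub] using hs

lemma exp_neg_mul_sq_mul_one_add_le {a : ℝ} (ha : 0 < a) (D y : ℝ) :
    Real.exp (-(a * y ^ 2)) * (1 + D * y) ≤ 1 + D ^ 2 / (4 * a) := by
  have hexp : Real.exp (-(a * y ^ 2)) * (1 + a * y ^ 2) ≤ 1 := by
    rw [Real.exp_neg, inv_mul_le_one₀ (Real.exp_pos _), add_comm]
    exact Real.add_one_le_exp _
  have hamgm : D * y ≤ a * y ^ 2 + D ^ 2 / (4 * a) := by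
    have : a * y ^ 2 + D ^ 2 / (4 * a) - D * y = (2 * a * y - D) ^ 2 / (4 * a) := by
      field_simp
      ring
    linarith [(by positivity : 0 ≤ (2 * a * y - D) ^ 2 / (4 * a))]
  calc Real.exp (-(a * y ^ 2)) * (1 + D * y)
      ≤ Real.exp (-(a * y ^ 2)) * (1 + a * y ^ 2 + D ^ 2 / (4 * a)) :=
        mul_le_mul_of_nonneg_left (by linarith) (Real.exp_nonneg _)
    _ = Real.exp (-(a * y ^ 2)) * (1 + a * y ^ 2)
        + Real.exp (-(a * y ^ 2)) * (D ^ 2 / (4 * a)) := mul_add _ _ _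
    _ ≤ 1 + D ^ 2 / (4 * a) := by
        gcongr
        exact mul_le_of_le_one_left (by positivity)
          (Real.exp_le_one_iff.2 (neg_nonpos.2 (by positivity)))

lemma inv_sqrt_le_one_add {v : ℝ} (hv : 1 / 2 ≤ v) : (√v)⁻¹ ≤ 1 + 2 * |v - 1| := by
  have hsqrt : 0 < √v := Real.sqrt_pos.2 (by linarith)
  rw [inv_le_iff_one_le_mul₀ hsqrt]
  rcases le_total v 1 with h | h
  · have hv' : v ≤ √v := Real.le_sqrt_of_sq_le (by nlinarith)
    rw [abs_of_nonpos (by linarith)]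
    nlinarith
  · nlinarith [Real.one_le_sqrt.2 h, abs_nonneg (v - 1)]

lemma exists_eventually_exp_mul_inv_sqrt_add_le (hK : AnalyticAt ℝ K 0) (hm : 3 ≤ m)
    (hmeven : Even m) (hlow : ∀ k < m, iteratedDeriv k K 0 = if k = 2 then 1 else 0)
    (hneg : iteratedDeriv m K 0 < 0) {A : ℝ} (hA : 0 ≤ A) :
    ∃ B : ℝ, 0 < B ∧ ∀ᶠ s in 𝓝 0, ∀ n : ℕ, 1 ≤ n →
      Real.exp (-(n * (s * deriv K s - K s - deriv K s ^ 2 / 2)))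
        * ((√(iteratedDeriv 2 K s))⁻¹ + A / n) ≤ 1 + B / n := by
  obtain ⟨c, hc, hexponent⟩ := exists_eventually_pow_le_legendre hK hm hmeven hlow hneg
  obtain ⟨D, hD, hvariance⟩ := exists_eventually_abs_iteratedDeriv_two_sub_one_le hK hlow
  have hhalf : ∀ᶠ s in 𝓝 (0 : ℝ), 1 / 2 < iteratedDeriv 2 K s :=
    (analyticAt_iteratedDeriv hK 2).continuousAt.eventually_const_lt
      (by rw [hlow 2 (by omega), if_pos rfl]; norm_num)
  refine ⟨D ^ 2 / c + A, by positivity, ?_⟩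
  filter_upwards [hexponent, hvariance, hhalf, Metric.ball_mem_nhds (0 : ℝ) one_pos]
    with s hexponent hvariance hhalf hs n hn
  let y := |s| ^ (m - 2)
  have hy : y ^ 2 ≤ s ^ m := by
    rw [← hmeven.pow_abs, ← pow_mul]
    exact pow_le_pow_of_le_one (abs_nonneg s) (by simpa using (mem_ball_zero_iff.1 hs).le)
      (by have := hmeven.two_dvd; omega)
  have hgain : c * n * y ^ 2 ≤ n * (s * deriv K s - K s - deriv K s ^ 2 / 2) :=
    calc c * n * y ^ 2 ≤ c * n * s ^ m := by gcongr
      _ = n * (c * s ^ m) := by ring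
      _ ≤ _ := by gcongr
  have hloss : (√(iteratedDeriv 2 K s))⁻¹ ≤ 1 + 2 * D * y := by
    linarith [inv_sqrt_le_one_add hhalf.le]
  calc _ ≤ Real.exp (-(c * n * y ^ 2)) * (1 + 2 * D * y + A / n) := by gcongr
    _ = Real.exp (-(c * n * y ^ 2)) * (1 + 2 * D * y)
        + Real.exp (-(c * n * y ^ 2)) * (A / n) := mul_add _ _ _
    _ ≤ 1 + (2 * D) ^ 2 / (4 * (c * n)) + A / n := by
        gcongr
        · exact exp_neg_mul_sq_mul_one_add_le (by positivity) _ _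
        · exact mul_le_of_le_one_left (by positivity)
            (Real.exp_le_one_iff.2 (neg_nonpos.2 (by positivity)))
    _ = 1 + (D ^ 2 / c + A) / n := by
        field_simp
        ring

end Expansion

/-! ### The local limit theorem -/

lemma exists_forall_abs_le_exists_eq {f : ℝ → ℝ} {f' : ℝ} (hf : HasStrictDerivAt f f' 0)
    (h0 : f 0 = 0) (hf' : f' ≠ 0) {S : Set ℝ} (hS : S ∈ 𝓝 0) :
    ∃ τ : ℝ, 0 < τ ∧ ∀ y, |y| ≤ τ → ∃ s ∈ S, f s = y := by
  have himage : f '' S ∈ 𝓝 0 := by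
    rw [← h0, ← hf.map_nhds_eq hf']
    exact image_mem_map hS
  obtain ⟨τ, hτ, hsub⟩ := Metric.nhds_basis_closedBall.mem_iff.1 himage
  exact ⟨τ, hτ, fun y hy => hsub (by simpa using hy)⟩

section Main

variable {Ω Ω' : Type*} [MeasurableSpace Ω] [MeasurableSpace Ω'] {P : Measure Ω}
  {P' : Measure Ω'} {X : Ω → ℝ} {ξ : ℕ → Ω' → ℝ}

lemma zero_mem_interior_integrableExpSet (hX : AEMeasurable X P)
    (hexp : ∃ b : ℝ, 0 < b ∧ Integrable (fun ω => Real.exp (b * |X ω|)) P) :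
    0 ∈ interior (integrableExpSet X P) := by
  obtain ⟨b, hb, hint⟩ := hexp
  refine mem_interior.2 ⟨Set.Ioo (-b) b, fun t ht => ?_, isOpen_Ioo, by simpa using hb⟩
  refine hint.mono' (by fun_prop : AEMeasurable _ P).aestronglyMeasurable
    (ae_of_all _ fun ω => ?_)
  rw [Real.norm_eq_abs, Real.abs_exp, Real.exp_le_exp]
  calc t * X ω ≤ |t| * |X ω| := (le_abs_self _).trans_eq (abs_mul _ _)
    _ ≤ b * |X ω| := by
        gcongr
        exact (abs_lt.2 ht).le

lemma cumulant_eq_ite [IsProbabilityMeasure P] (h0 : 0 ∈ interior (integrableExpSet X P))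
    (hmean : ∫ ω, X ω ∂P = 0) (hvar : variance X P = 1) {m : ℕ}
    (hzero : ∀ k, 3 ≤ k → k < m → cumulant X P k = 0) :
    ∀ k < m, cumulant X P k = if k = 2 then 1 else 0 := by
  intro k hk
  rcases lt_or_ge k 3 with hk3 | hk3
  · interval_cases k
    · simp [cumulant]
    · simp [cumulant, iteratedDeriv_one, deriv_cgf_zero h0, hmean]
    · rw [cumulant, ← variance_tilted_mul h0, if_pos rfl, ← hvar]
      simp
  · rw [hzero k hk3 hk, if_neg (by omega)]

lemma div_le_mul_log_pow_div {c : ℝ} (hc : 0 ≤ c) {n : ℕ} (hn : 2 ≤ n) (j : ℕ) :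
    c / n ≤ c / Real.log 2 ^ j * Real.log n ^ j / n := by
  have : 0 < Real.log 2 := Real.log_pos one_lt_two
  have hlog : Real.log 2 ≤ Real.log n := Real.log_le_log two_pos (by exact_mod_cast hn)
  gcongr
  rw [div_mul_eq_mul_div, le_div_iff₀ (by positivity)]
  gcongr

end Main

end LocalLimit

end

open Filter Topology LocalLimit

theorem corollary1p3_general
    {Ω Ω' : Type*} [MeasurableSpace Ω] [MeasurableSpace Ω']
    (P : Measure Ω) [IsProbabilityMeasure P] (P' : Measure Ω')
    (X : Ω → ℝ) (ξ : ℕ → Ω' → ℝ)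
    (hindep : iIndepFun ξ P') (hident : ∀ i, IdentDistrib (ξ i) X P' P)
    (hmean : ∫ ω, X ω ∂P = 0) (hvar : variance X P = 1)
    (n₀ : ℕ) (hn₀ : 1 ≤ n₀)
    (hbdd : ∃ p : ℝ → ℝ, IsDensity p (normalizedSum ξ n₀) P' ∧ IsBoundedAbove p)
    (hexp : ∃ b : ℝ, 0 < b ∧ Integrable (fun ω => Real.exp (b * |X ω|)) P)
    (m : ℕ) (hm : 3 ≤ m) (hmeven : Even m)
    (hzero : ∀ k, 3 ≤ k → k < m → cumulant X P k = 0) (hneg : cumulant X P m < 0) :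
    ∃ τ₀ : ℝ, 0 < τ₀ ∧ ∃ c : ℝ, 0 < c ∧ ∀ n : ℕ, 2 * n₀ ≤ n →
      (∃ p : ℝ → ℝ, Continuous p ∧ IsBoundedAbove p ∧ IsDensity p (normalizedSum ξ n) P') ∧
      ∀ p : ℝ → ℝ, Continuous p → IsDensity p (normalizedSum ξ n) P' →
        ∀ x : ℝ, |x / √(n : ℝ)| ≤ τ₀ →
          (p x - gaussianPDFReal 0 1 x) / gaussianPDFReal 0 1 x ≤ c / n := by
  obtain ⟨p₀, hp₀, hb₀⟩ := hbdd
  have h0 := zero_mem_interior_integrableExpSet (hident 0).aemeasurable_snd hexp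
  have hK := analyticAt_cgf h0
  have hlow := cumulant_eq_ite h0 hmean hvar hzero
  have hvar' : iteratedDeriv 2 (cgf X P) 0 = 1 := hlow 2 (by omega)
  have hmean' : deriv (cgf X P) 0 = 0 := by simp [deriv_cgf_zero h0, hmean]
  obtain ⟨A, hA, hsaddle⟩ :=
    exists_eventually_div_gaussianPDFReal_le h0 (by simp [hvar']) hindep hident hn₀ hp₀ hb₀
  obtain ⟨c, hc, hratio⟩ := exists_eventually_exp_mul_inv_sqrt_add_le hK hm hmeven hlow hneg hA
  obtain ⟨τ, hτ, hsolve⟩ := exists_forall_abs_le_exists_eq hK.deriv.hasStrictDerivAt hmean'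
    (by rw [← iteratedDeriv_one, ← iteratedDeriv_succ', hvar']; exact one_ne_zero)
    (hsaddle.and hratio)
  refine ⟨τ, hτ, c, hc, fun n hn => ⟨exists_continuous_isDensity_normalizedSum hindep hident hn₀
    hp₀ hb₀ hn, fun p hpc hp x hx => ?_⟩⟩
  obtain ⟨s, ⟨hsaddle, hratio⟩, hs⟩ := hsolve _ hx
  have hx : x = √(n : ℝ) * deriv (cgf X P) s := by
    have hn1 : 1 ≤ n := by omega
    rw [hs, mul_div_cancel₀ _ (by positivity)]
  rw [sub_div, div_self (gaussianPDFReal_pos 0 1 x one_ne_zero).ne', sub_le_iff_le_add', hx]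
  exact (hsaddle n hn p hpc hp _).trans (hratio n (by omega))

theorem corollary1p3
    {Ω Ω' : Type*} [MeasurableSpace Ω] [MeasurableSpace Ω']
    (P : Measure Ω) [IsProbabilityMeasure P] (P' : Measure Ω') [IsProbabilityMeasure P']
    -- a random variable `X` and a sequence `ξ` of independent copies of it
    (X : Ω → ℝ) (ξ : ℕ → Ω' → ℝ)
    (hindep : iIndepFun ξ P') (hident : ∀ i, IdentDistrib (ξ i) X P' P)
    (hmean : ∫ ω, X ω ∂P = 0) (hvar : variance X P = 1)
    -- for `n = n₀` the normalized sum has a bounded density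
    (n₀ : ℕ) (hn₀ : 1 ≤ n₀)
    (hbdd : ∃ p : ℝ → ℝ, LocalLimit.IsDensity p (LocalLimit.normalizedSum ξ n₀) P' ∧
      LocalLimit.IsBoundedAbove p)
    -- `X` has a finite exponential moment
    (hexp : ∃ b : ℝ, 0 < b ∧ Integrable (fun ω => Real.exp (b * |X ω|)) P)
    -- `γ_m` is the first nonzero cumulant of order at least `3`, `m` is even and `γ_m < 0`
    (m : ℕ) (hm4 : 4 ≤ m) (hmeven : Even m)
    (hzero : ∀ k, 3 ≤ k → k < m → LocalLimit.cumulant X P k = 0)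
    (hneg : LocalLimit.cumulant X P m < 0) :
    ∃ τ₀ : ℝ, 0 < τ₀ ∧ ∃ c : ℝ, 0 < c ∧ ∀ n : ℕ, 2 * n₀ ≤ n →
      (∃ p : ℝ → ℝ, Continuous p ∧ LocalLimit.IsBoundedAbove p ∧
        LocalLimit.IsDensity p (LocalLimit.normalizedSum ξ n) P') ∧
      ∀ p : ℝ → ℝ, Continuous p → LocalLimit.IsDensity p (LocalLimit.normalizedSum ξ n) P' →
        ∀ x : ℝ, |x / √(n : ℝ)| ≤ τ₀ →
          (p x - gaussianPDFReal 0 1 x) / gaussianPDFReal 0 1 x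
            ≤ c * Real.log n ^ 3 / n := by
  obtain ⟨τ, hτ, c, hc, h⟩ := corollary1p3_general P P' X ξ hindep hident hmean hvar n₀ hn₀ hbdd
    hexp m (by omega) hmeven hzero hneg
  exact ⟨τ, hτ, c / Real.log 2 ^ 3, div_pos hc (pow_pos (Real.log_pos one_lt_two) 3),
    fun n hn => ⟨(h n hn).1, fun p hpc hp x hx =>
      ((h n hn).2 p hpc hp x hx).trans (div_le_mul_log_pow_div hc.le (by omega) 3)⟩⟩
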